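/- **Theorem 4.10 (Weighted $L^p$-estimate).** Let $d\ge 1$, $K\in\mathbb N_0$, and let a *mesh* be a triple $(\Omega,\mathcal T,\delta)$, where $\Omega\subset\mathbb R^d$ is a bounded polyhedral domain, $\mathcal T$ is a regular (face-to-face) triangulation of $\Omega$ into finitely many closed simplices, and $\delta:\mathcal T\times\mathcal T\to\mathbb N_0$ is the geodesic distance induced by a symmetric neighbour relation between distinct simplices such that neighbouring simplices intersect and any two simplices are joined by a chain of neighbours (so $\delta(T,T')$ is the least length of such a chain). For a mesh put $$\mathcal L^1_K(\mathcal T)=\{v\in W^{1,\infty}(\Omega): v|_T \text{ is a polynomial of degree at most } K \text{ for all } T\in\mathcal T\},$$ and let $Q:L^1(\Omega)\to\mathcal L^1_K(\mathcal T)$ be the (extended) $L^2$-projection, defined by $\int_\Omega (Qu)\,v\,dx=\int_\Omega u\,v\,dx$ for all $v\in\mathcal L^1_K(\mathcal T)$. A function $\rho\in L^1(\Omega)$, positive a.e., is a *weight with grading* $\gamma\ge1$ if $\operatorname{ess\,sup}_T\rho\le\gamma\operatorname{ess\,inf}_T\rho$ for all $T\in\mathcal T$, and $\operatorname{ess\,sup}_{T'}\rho\le\gamma\operatorname{ess\,sup}_T\rho$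 and $\operatorname{ess\,inf}_{T'}\rho\le\gamma\operatorname{ess\,inf}_T\rho$ whenever $\delta(T,T')=1$. A *mesh size function with grading $\gamma$ and constant $\kappa$* is a weight $h$ with grading $\gamma$ such that $\operatorname{diam}T\le\kappa\operatorname{ess\,inf}_T h$ and $\operatorname{ess\,sup}_T h\le\kappa\operatorname{diam}T$ for all $T\in\mathcal T$. A mesh is *shape regular with parameter* $\chi_0$ if every $T\in\mathcal T$ contains a ball of radius $r>0$ with $\operatorname{diam}T\le 2\chi_0 r$. Let $\mathfrak T$ be a family of meshes in $\mathbb R^d$ (for example, a single mesh, or all meshes produced by a refinement strategy; the domain $\Omega$ may vary within the family) that are shape regular with a common parameter $\chi_0$. Its *worst grading* $\gamma_{\max}\in[1,\infty]$ is the supremum of all $\Gamma\in[0,\infty]$ such that for every $\gamma$ with $1\le\gamma<\Gamma$ there is a constant $C(\gamma)<\infty$ with $$\|\rho\,Qu\|_{L^2(\Omega)}\le C(\gamma)\,\|\rho u\|_{L^2(\Omega)}$$ for all meshes of $\mathfrak T$, all weights $\rho$ with grading $\gamma$ and all $u\in L^2(\Omega)$. Let $p\in[1,\infty]$ and let $\gamma_\rho,\gamma_h,\kappa$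 be real numbers with $$\gamma_\rho\,\gamma_h^{\,d\left|\frac12-\frac1p\right|}<\gamma_{\max}.$$ Then there is a constant $c<\infty$, depending only on $\mathfrak T$, $\gamma_\rho,\gamma_h,\kappa,d,p,K,\chi_0$, such that for every mesh in $\mathfrak T$, every weight $\rho$ with grading $\gamma_\rho$, and provided that a mesh size function with grading $\gamma_h$ and constant $\kappa$ exists on this mesh, $$\|\rho\,Qu\|_{L^p(\Omega)}\le c\,\|\rho u\|_{L^p(\Omega)}\qquad\text{for all }u\in L^p(\Omega).$$ In particular, $c$ is the same for all meshes of the family, all such $\rho$ and $h$, and all $u$. -/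

import Mathlib

open MeasureTheory
open scoped ENNReal NNReal ContDiff

namespace WeightedLp

/-- `d`-dimensional Euclidean space. -/
abbrev Euc (d : ℕ) : Type := EuclideanSpace ℝ (Fin d)

/-- The closed simplex with vertex set `s`. -/
def simplex {d : ℕ} (s : Finset (Euc d)) : Set (Euc d) := convexHull ℝ (s : Set (Euc d))

/-- A bounded polyhedral domain `Ω ⊆ ℝᵈ` together with a regular (face-to-face) triangulation of it
into closed nondegenerate simplices. A simplex is stored through its `d + 1` vertices. -/
structure Triangulation (d : ℕ) where
  /-- the domain -/
  Ω : Set (Euc d)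
  /-- the vertex sets of the simplices -/
  cells : Finset (Finset (Euc d))
  isOpen : IsOpen Ω
  isConnected : IsConnected Ω
  card_eq : ∀ s ∈ cells, s.card = d + 1
  affineIndependent : ∀ s ∈ cells, AffineIndependent ℝ ((↑) : s → Euc d)
  /-- Two simplices meet in their common face, which may be empty. -/
  inter_subset : ∀ s ∈ cells, ∀ t ∈ cells,
    simplex s ∩ simplex t ⊆ convexHull ℝ ((s : Set (Euc d)) ∩ (t : Set (Euc d)))
  /-- The simplices cover the closed domain (which is therefore compact). -/
  closure_eq : closure Ω = ⋃ s ∈ cells, simplex s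
  /-- The boundary of the domain is made of pieces of boundaries of simplices. -/
  interior_subset : ∀ s ∈ cells, interior (simplex s) ⊆ Ω

/-- `g` is the `i`-th weak partial derivative of `v` on the open set `Ω`. -/
def HasWeakPartial {d : ℕ} (Ω : Set (Euc d)) (i : Fin d) (v g : Euc d → ℝ) : Prop :=
  ∀ φ : Euc d → ℝ, ContDiff ℝ ∞ φ → HasCompactSupport φ → tsupport φ ⊆ Ω →
    ∫ x in Ω, v x * fderiv ℝ φ x (EuclideanSpace.single i 1) = - ∫ x in Ω, g x * φ x

/-- `v ∈ W^{1,∞}(Ω)`. -/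
def MemW1Infty {d : ℕ} (Ω : Set (Euc d)) (v : Euc d → ℝ) : Prop :=
  MemLp v ∞ (volume.restrict Ω) ∧
    ∀ i, ∃ g : Euc d → ℝ, MemLp g ∞ (volume.restrict Ω) ∧ HasWeakPartial Ω i v g

/-- On every simplex, `v` agrees almost everywhere with a polynomial of total degree at most `K`. -/
def Triangulation.PiecewisePoly {d : ℕ} (M : Triangulation d) (K : ℕ) (v : Euc d → ℝ) : Prop :=
  ∀ s ∈ M.cells, ∃ P : MvPolynomial (Fin d) ℝ, P.totalDegree ≤ K ∧
    v =ᵐ[volume.restrict (simplex s)] fun x => MvPolynomial.eval (fun i => x i) P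

/-- Membership in the space of Lagrange finite elements of degree `K`: functions in `W^{1,∞}(Ω)`
that are piecewise polynomial of degree at most `K`. -/
def Triangulation.IsLagrange {d : ℕ} (M : Triangulation d) (K : ℕ) (v : Euc d → ℝ) : Prop :=
  MemW1Infty M.Ω v ∧ M.PiecewisePoly K v

/-- `w` is the `L²`-projection of `u` onto the Lagrange space: `w` lies in that space and
`⟨w, v⟩ = ⟨u, v⟩` for all `v` in it. This makes sense for all `u ∈ L¹(Ω)`. -/
def Triangulation.IsL2Proj {d : ℕ} (M : Triangulation d) (K : ℕ) (u w : Euc d → ℝ) : Prop :=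
  M.IsLagrange K w ∧
    ∀ v, M.IsLagrange K v → ∫ x in M.Ω, w x * v x = ∫ x in M.Ω, u x * v x

open Classical in
/-- The `L²`-projection `Q`, extended to `L¹(Ω)`; see `l2Proj_spec` and `IsL2Proj.ae_eq` for
existence and uniqueness. (The value is `0` for functions that are not integrable.) -/
noncomputable def Triangulation.l2Proj {d : ℕ} (M : Triangulation d) (K : ℕ) (u : Euc d → ℝ) :
    Euc d → ℝ :=
  if h : ∃ w, M.IsL2Proj K u w then h.choose else 0

section Existence

variable {d : ℕ}

lemma Triangulation.isBounded (M : Triangulation d) : Bornology.IsBounded M.Ω := by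
  refine Bornology.IsBounded.subset ?_ subset_closure
  rw [M.closure_eq]
  refine (Bornology.isBounded_biUnion_finset M.cells).2 fun s _ => ?_
  exact (isBounded_convexHull).2 s.finite_toSet.isBounded

instance (M : Triangulation d) : IsFiniteMeasure (volume.restrict M.Ω) :=
  ⟨by simpa using M.isBounded.measure_lt_top⟩

lemma integrable_mul_fderiv {μ : Measure (Euc d)} [IsFiniteMeasure μ] {v φ : Euc d → ℝ}
    (hv : MemLp v ∞ μ) (hφ : ContDiff ℝ ∞ φ) (hc : HasCompactSupport φ) (e : Euc d) :
    Integrable (fun x => v x * fderiv ℝ φ x e) μ := by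
  have h1 : Continuous fun x => fderiv ℝ φ x e :=
    (hφ.continuous_fderiv (by simp)).clm_apply continuous_const
  have h2 : HasCompactSupport fun x => fderiv ℝ φ x e := hc.fderiv_apply (𝕜 := ℝ) e
  have h3 : Integrable (fun x => fderiv ℝ φ x e) μ :=
    h1.integrable_of_hasCompactSupport h2
  exact h3.mul_of_top_right hv

lemma integrable_mul_test {μ : Measure (Euc d)} [IsFiniteMeasure μ] {v φ : Euc d → ℝ}
    (hv : MemLp v ∞ μ) (hφ : ContDiff ℝ ∞ φ) (hc : HasCompactSupport φ) :
    Integrable (fun x => v x * φ x) μ :=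
  (hφ.continuous.integrable_of_hasCompactSupport hc).mul_of_top_right hv

lemma Triangulation.IsLagrange.zero (M : Triangulation d) (K : ℕ) :
    M.IsLagrange K (fun _ => 0) := by
  refine ⟨⟨MemLp.zero', fun i => ⟨fun _ => 0, MemLp.zero', fun φ _ _ _ => by simp⟩⟩,
    fun s _ => ⟨0, by simp, by simp⟩⟩

lemma Triangulation.IsLagrange.add {M : Triangulation d} {K : ℕ} {v w : Euc d → ℝ}
    (hv : M.IsLagrange K v) (hw : M.IsLagrange K w) : M.IsLagrange K (fun x => v x + w x) := by
  refine ⟨⟨hv.1.1.add hw.1.1, fun i => ?_⟩, fun s hs => ?_⟩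
  · obtain ⟨g, hg, hg'⟩ := hv.1.2 i
    obtain ⟨k, hk, hk'⟩ := hw.1.2 i
    refine ⟨fun x => g x + k x, hg.add hk, fun φ h1 h2 h3 => ?_⟩
    simp only [add_mul]
    rw [integral_add (integrable_mul_fderiv hv.1.1 h1 h2 _)
      (integrable_mul_fderiv hw.1.1 h1 h2 _),
      integral_add (integrable_mul_test hg h1 h2) (integrable_mul_test hk h1 h2),
      hg' φ h1 h2 h3, hk' φ h1 h2 h3]
    ring
  · obtain ⟨P, hP, hP'⟩ := hv.2 s hs
    obtain ⟨R, hR, hR'⟩ := hw.2 s hs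
    refine ⟨P + R, (MvPolynomial.totalDegree_add P R).trans (max_le hP hR), ?_⟩
    filter_upwards [hP', hR'] with x h1 h2
    simp [h1, h2]

lemma Triangulation.IsLagrange.smul {M : Triangulation d} {K : ℕ} {v : Euc d → ℝ} (c : ℝ)
    (hv : M.IsLagrange K v) : M.IsLagrange K (fun x => c * v x) := by
  refine ⟨⟨hv.1.1.const_mul c, fun i => ?_⟩, fun s hs => ?_⟩
  · obtain ⟨g, hg, hg'⟩ := hv.1.2 i
    refine ⟨fun x => c * g x, hg.const_mul c, fun φ h1 h2 h3 => ?_⟩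
    simp only [mul_assoc]
    rw [integral_const_mul, integral_const_mul, hg' φ h1 h2 h3]
    ring
  · obtain ⟨P, hP, hP'⟩ := hv.2 s hs
    refine ⟨MvPolynomial.C c * P, ?_, ?_⟩
    · rw [← MvPolynomial.smul_eq_C_mul]
      exact (MvPolynomial.totalDegree_smul_le c P).trans hP
    · filter_upwards [hP'] with x h1
      simp [h1]

/-- The Lagrange space as a subspace of `L²(Ω)`. -/
noncomputable def Triangulation.lagrangeL2 (M : Triangulation d) (K : ℕ) :
    Submodule ℝ (Lp ℝ 2 (volume.restrict M.Ω)) where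
  carrier := {f | ∃ v, M.IsLagrange K v ∧ f =ᵐ[volume.restrict M.Ω] v}
  zero_mem' := ⟨_, .zero M K, Lp.coeFn_zero _ _ _⟩
  add_mem' := by
    rintro f g ⟨v, hv, hf⟩ ⟨w, hw, hg⟩
    refine ⟨_, hv.add hw, ?_⟩
    filter_upwards [hf, hg, Lp.coeFn_add f g] with x h1 h2 h3
    exact h3.trans (congrArg₂ (· + ·) h1 h2)
  smul_mem' := by
    rintro c f ⟨v, hv, hf⟩
    refine ⟨_, hv.smul c, ?_⟩
    filter_upwards [hf, Lp.coeFn_smul c f] with x h1 h2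
    exact h2.trans (congrArg (c * ·) h1)

lemma isCompact_simplex (s : Finset (Euc d)) : IsCompact (simplex s) :=
  s.finite_toSet.isCompact_convexHull (𝕜 := ℝ)

/-- A polynomial as an element of `L²` of a simplex, inside `Ω`. -/
lemma memLp_poly (M : Triangulation d) (s : Finset (Euc d)) (P : MvPolynomial (Fin d) ℝ) :
    MemLp (fun x : Euc d => MvPolynomial.eval (fun i => x i) P) 2
      ((volume.restrict M.Ω).restrict (simplex s)) := by
  have hc : Continuous fun x : Euc d => MvPolynomial.eval (fun i => x i) P :=
    (MvPolynomial.continuous_eval P).comp (by fun_prop)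
  obtain ⟨C, hC⟩ := (isCompact_simplex s).exists_bound_of_continuousOn hc.continuousOn
  refine MemLp.of_bound hc.aestronglyMeasurable C ?_
  exact (ae_restrict_iff' (isCompact_simplex s).measurableSet).2 (.of_forall hC)

/-- Polynomials of bounded degree as elements of `L²` of a simplex. -/
noncomputable def polyToLp (M : Triangulation d) (s : Finset (Euc d)) (K : ℕ) :
    MvPolynomial.restrictTotalDegree (Fin d) ℝ K →ₗ[ℝ]
      Lp ℝ 2 ((volume.restrict M.Ω).restrict (simplex s)) where
  toFun P := (memLp_poly M s P.1).toLp _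
  map_add' P R := by
    rw [← MemLp.toLp_add]
    congr 1
    ext x
    simp
  map_smul' c P := by
    simp only [RingHom.id_apply]
    rw [← MemLp.toLp_const_smul]
    congr 1
    ext x
    simp [MvPolynomial.smul_eval]

instance (M : Triangulation d) (K : ℕ) : FiniteDimensional ℝ (M.lagrangeL2 K) := by
  let μ := volume.restrict M.Ω
  let Φ : Lp ℝ 2 μ →ₗ[ℝ] ((s : M.cells) → Lp ℝ 2 (μ.restrict (simplex s.1))) :=
    LinearMap.pi fun s => (LpToLpRestrictCLM (Euc d) ℝ ℝ μ 2 (simplex s.1)).toLinearMap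
  let Θ : (M.cells → MvPolynomial.restrictTotalDegree (Fin d) ℝ K) →ₗ[ℝ]
      ((s : M.cells) → Lp ℝ 2 (μ.restrict (simplex s.1))) :=
    LinearMap.pi fun s => (polyToLp M s.1 K).comp (LinearMap.proj s)
  let W := LinearMap.range Θ
  have hΦ : ∀ f ∈ M.lagrangeL2 K, Φ f ∈ W := by
    rintro f ⟨v, hv, hf⟩
    choose P hP hP' using hv.2
    refine ⟨fun s => ⟨P s.1 s.2, (MvPolynomial.mem_restrictTotalDegree _ _ _).2 (hP _ _)⟩, ?_⟩
    funext s
    apply Lp.ext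
    have e1 : f =ᵐ[μ.restrict (simplex s.1)] v := ae_restrict_of_ae hf
    have e2 : v =ᵐ[μ.restrict (simplex s.1)] fun x => MvPolynomial.eval (fun i => x i) (P s.1 s.2) :=
      (Measure.restrict_mono_measure Measure.restrict_le_self _).absolutelyContinuous.ae_le (hP' s.1 s.2)
    have e3 := LpToLpRestrictCLM_coeFn ℝ (simplex s.1) f
    have e4 := (memLp_poly M s.1 (P s.1 s.2)).coeFn_toLp
    exact e4.trans ((e3.trans (e1.trans e2)).symm)
  have hinj : Function.Injective Φ := by
    rw [← LinearMap.ker_eq_bot, LinearMap.ker_eq_bot']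
    intro f hf
    apply Lp.ext
    have h0 : ∀ s ∈ M.cells, ∀ᵐ x ∂(μ.restrict (simplex s)), f x = 0 := by
      intro s hs
      have e1 := congrFun hf ⟨s, hs⟩
      have e3 := LpToLpRestrictCLM_coeFn ℝ (simplex s) f
      have e4 : (LpToLpRestrictCLM (Euc d) ℝ ℝ μ 2 (simplex s)) f = 0 := e1
      rw [e4] at e3
      filter_upwards [e3, Lp.coeFn_zero ℝ 2 (μ.restrict (simplex s))] with x h1 h2
      rw [← h1, h2]; rfl
    have h1 : ∀ᵐ x ∂(μ.restrict (⋃ s ∈ M.cells, simplex s)), f x = 0 :=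
      (ae_restrict_biUnion_finset_iff _ _ _).2 h0
    have h2 : μ.restrict (⋃ s ∈ M.cells, simplex s) = μ := by
      rw [← M.closure_eq, Measure.restrict_restrict isClosed_closure.measurableSet,
        Set.inter_eq_right.2 subset_closure]
    rw [h2] at h1
    filter_upwards [h1, Lp.coeFn_zero ℝ 2 μ] with x h3 h4
    rw [h3, h4]; rfl
  let Ψ : M.lagrangeL2 K →ₗ[ℝ] W :=
    (Φ.comp (M.lagrangeL2 K).subtype).codRestrict W fun f => hΦ f.1 f.2
  refine FiniteDimensional.of_injective Ψ fun f g hfg => ?_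
  exact Subtype.ext (hinj (congrArg Subtype.val hfg))

lemma Triangulation.exists_isL2Proj (M : Triangulation d) (K : ℕ) {u : Euc d → ℝ}
    (hu : IntegrableOn u M.Ω) : ∃ w, M.IsL2Proj K u w := by
  have hint : ∀ f : M.lagrangeL2 K, Integrable (fun x => u x * f.1 x) (volume.restrict M.Ω) := by
    rintro ⟨f, v, hv, hf⟩
    exact hu.mul_of_top_left (hv.1.1.ae_eq hf.symm)
  let ℓ : M.lagrangeL2 K →ₗ[ℝ] ℝ :=
    { toFun := fun f => ∫ x in M.Ω, u x * f.1 x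
      map_add' := fun f g => by
        rw [← integral_add (hint f) (hint g)]
        refine integral_congr_ae ?_
        filter_upwards [Lp.coeFn_add f.1 g.1] with x hx
        simp only [Submodule.coe_add, hx, Pi.add_apply]
        ring
      map_smul' := fun c f => by
        simp only [RingHom.id_apply, smul_eq_mul]
        rw [← integral_const_mul]
        refine integral_congr_ae ?_
        filter_upwards [Lp.coeFn_smul c f.1] with x hx
        simp only [Submodule.coe_smul, hx, Pi.smul_apply, smul_eq_mul]
        ring }
  have : CompleteSpace (M.lagrangeL2 K) := FiniteDimensional.complete ℝ _
  let r := (InnerProductSpace.toDual ℝ (M.lagrangeL2 K)).symm (LinearMap.toContinuousLinearMap ℓ)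
  obtain ⟨w, hw, hrw⟩ := r.2
  refine ⟨w, hw, fun v hv => ?_⟩
  have hv2 : MemLp v 2 (volume.restrict M.Ω) := hv.1.1.mono_exponent le_top
  let f : M.lagrangeL2 K := ⟨hv2.toLp v, v, hv, hv2.coeFn_toLp⟩
  have key : inner ℝ r f = ℓ f := by
    simp [r, InnerProductSpace.toDual_symm_apply]
  have e1 : inner ℝ r f = ∫ x in M.Ω, w x * v x := by
    rw [Submodule.coe_inner, L2.inner_def]
    refine integral_congr_ae ?_
    filter_upwards [hrw, hv2.coeFn_toLp] with x h1 h2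
    simp only [f, h1, h2, RCLike.inner_apply, conj_trivial]
    ring
  have e2 : ℓ f = ∫ x in M.Ω, u x * v x := by
    refine integral_congr_ae ?_
    filter_upwards [hv2.coeFn_toLp] with x h2
    simp only [f, h2]
  rw [← e1, key, e2]

/-- For `u ∈ L¹(Ω)`, the function `Q u` is the `L²`-projection of `u`. -/
lemma Triangulation.l2Proj_spec (M : Triangulation d) (K : ℕ) {u : Euc d → ℝ}
    (hu : IntegrableOn u M.Ω) : M.IsL2Proj K u (M.l2Proj K u) := by
  have h := M.exists_isL2Proj K hu
  rw [Triangulation.l2Proj, dif_pos h]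
  exact h.choose_spec

/-- The `L²`-projection is unique up to null sets. -/
lemma Triangulation.IsL2Proj.ae_eq {M : Triangulation d} {K : ℕ} {u w₁ w₂ : Euc d → ℝ}
    (h₁ : M.IsL2Proj K u w₁) (h₂ : M.IsL2Proj K u w₂) : w₁ =ᵐ[volume.restrict M.Ω] w₂ := by
  have hd : M.IsLagrange K (fun x => w₁ x + (-1) * w₂ x) := h₁.1.add (h₂.1.smul (-1))
  have m1 : MemLp w₁ ∞ (volume.restrict M.Ω) := h₁.1.1.1
  have m2 : MemLp w₂ ∞ (volume.restrict M.Ω) := h₂.1.1.1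
  have md : MemLp (fun x => w₁ x + (-1) * w₂ x) ∞ (volume.restrict M.Ω) := hd.1.1
  have i1 : Integrable (fun x => w₁ x * (w₁ x + (-1) * w₂ x)) (volume.restrict M.Ω) :=
    (m1.integrable le_top).mul_of_top_left md
  have i2 : Integrable (fun x => w₂ x * (w₁ x + (-1) * w₂ x)) (volume.restrict M.Ω) :=
    (m2.integrable le_top).mul_of_top_left md
  have i3 := (md.integrable le_top).mul_of_top_left md
  have h0 : ∫ x in M.Ω, (w₁ x + (-1) * w₂ x) * (w₁ x + (-1) * w₂ x) = 0 := by
    have e : ∀ x, (w₁ x + (-1) * w₂ x) * (w₁ x + (-1) * w₂ x) =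
        w₁ x * (w₁ x + (-1) * w₂ x) - w₂ x * (w₁ x + (-1) * w₂ x) := fun x => by ring
    simp_rw [e]
    rw [integral_sub i1 i2, h₁.2 _ hd, h₂.2 _ hd, sub_self]
  have h1 := (integral_eq_zero_iff_of_nonneg (fun x => mul_self_nonneg _) i3).1 h0
  filter_upwards [h1] with x hx
  have := mul_self_eq_zero.1 hx
  linarith

end Existence

/-- A triangulation with a symmetric notion of neighbours. Distinct neighbouring simplices intersect,
and any two simplices are joined by a chain of neighbours. -/
structure Mesh (d : ℕ) extends Triangulation d where
  /-- the neighbour relation -/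
  nbr : SimpleGraph {s // s ∈ cells}
  inter_nonempty : ∀ s t, nbr.Adj s t → (simplex s.1 ∩ simplex t.1).Nonempty
  nbr_connected : nbr.Connected

/-- The geodesic distance of two simplices: the least length of a chain of neighbours. -/
noncomputable def Mesh.δ {d : ℕ} (M : Mesh d) (s t : {s // s ∈ M.cells}) : ℕ := M.nbr.dist s t

/-- Essential supremum of a positive function on a simplex, with values in `[0, ∞]`. -/
noncomputable def supOn {d : ℕ} (s : Finset (Euc d)) (ρ : Euc d → ℝ) : ℝ≥0∞ :=
  essSup (fun x => ENNReal.ofReal (ρ x)) (volume.restrict (simplex s))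

/-- Essential infimum of a positive function on a simplex, with values in `[0, ∞]`. -/
noncomputable def infOn {d : ℕ} (s : Finset (Euc d)) (ρ : Euc d → ℝ) : ℝ≥0∞ :=
  essInf (fun x => ENNReal.ofReal (ρ x)) (volume.restrict (simplex s))

/-- `ρ` is a weight with grading `γ` (with respect to the distance `δ`). -/
structure Mesh.IsWeight {d : ℕ} (M : Mesh d) (ρ : Euc d → ℝ) (γ : ℝ) : Prop where
  one_le : 1 ≤ γ
  integrableOn : IntegrableOn ρ M.Ω
  pos : ∀ᵐ x ∂volume.restrict M.Ω, 0 < ρ x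
  sup_le_inf : ∀ s ∈ M.cells, supOn s ρ ≤ ENNReal.ofReal γ * infOn s ρ
  sup_le_sup : ∀ s t, M.δ s t = 1 → supOn t.1 ρ ≤ ENNReal.ofReal γ * supOn s.1 ρ
  inf_le_inf : ∀ s t, M.δ s t = 1 → infOn t.1 ρ ≤ ENNReal.ofReal γ * infOn s.1 ρ

/-- `h` is a mesh size function with grading `γ` whose equivalence to the local diameters holds with
the constant `κ`. (As `infOn s h ≤ supOn s h`, the two other bounds follow.) -/
structure Mesh.IsMeshSize {d : ℕ} (M : Mesh d) (h : Euc d → ℝ) (γ κ : ℝ) : Prop where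
  isWeight : M.IsWeight h γ
  diam_le : ∀ s ∈ M.cells,
    ENNReal.ofReal (Metric.diam (simplex s)) ≤ ENNReal.ofReal κ * infOn s h
  le_diam : ∀ s ∈ M.cells,
    supOn s h ≤ ENNReal.ofReal κ * ENNReal.ofReal (Metric.diam (simplex s))

/-- Every simplex contains a ball whose diameter times `χ` is at least the diameter of the simplex. -/
def Triangulation.ShapeRegular {d : ℕ} (M : Triangulation d) (χ : ℝ) : Prop :=
  ∀ s ∈ M.cells, ∃ (x : Euc d) (r : ℝ), 0 < r ∧ Metric.closedBall x r ⊆ simplex s ∧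
    Metric.diam (simplex s) ≤ χ * (2 * r)

/-- The bound `‖ρ Q u‖_p ≤ C ‖ρ u‖_p` for all `u ∈ L^p(Ω)`. -/
def Triangulation.WeightedStable {d : ℕ} (M : Triangulation d) (K : ℕ) (p : ℝ≥0∞)
    (ρ : Euc d → ℝ) (C : ℝ≥0) : Prop :=
  ∀ u : Euc d → ℝ, MemLp u p (volume.restrict M.Ω) →
    eLpNorm (fun x => ρ x * M.l2Proj K u x) p (volume.restrict M.Ω) ≤
      C * eLpNorm (fun x => ρ x * u x) p (volume.restrict M.Ω)

/-- The worst grading `γ_max ∈ [1, ∞]` of a family of meshes: the largest `Γ` such that for every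
`γ < Γ` the weighted `L²`-estimate holds for all weights with grading `γ`, with a constant that
depends on `γ` (and on the family) only. -/
noncomputable def worstGrading {d : ℕ} (𝔗 : Set (Mesh d)) (K : ℕ) : ℝ≥0∞ :=
  sSup {Γ : ℝ≥0∞ | ∀ γ : ℝ, 1 ≤ γ → ENNReal.ofReal γ < Γ →
    ∃ C : ℝ≥0, ∀ M ∈ 𝔗, ∀ ρ, M.IsWeight ρ γ → M.WeightedStable K 2 ρ C}

end WeightedLp

/-! For `p = 2` the estimate is the definition of the worst grading. The case `p < 2` follows from
`p > 2` by duality (`weightedStable_of_conjugate`): `Q` is self-adjoint, `|1/2 - 1/p|` is the same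
for conjugate exponents, and once `ρ` is replaced by its infima over the simplices, `1/ρ` has the
same grading between neighbours.

For `p > 2` the estimate is extrapolated from `L²`. Let `1/p + 1/r = 1/2`, so that `d |1/2 - 1/p| =
d/r`. As `Qu` is piecewise polynomial, it is bounded on each simplex `T` by a number `A_T` with
`A_T² |T| ≤ C ∫_T |Qu|²` (`exists_inverse_estimate`). One would like to use the weight `ρ g` in `L²`
with `g ≥ 0` an arbitrary piecewise constant function, but `g` has no grading. Its majorant `H(T) =
max β^(-δ(T,T')) g(T')` has grading `β`, so `ρ H` has grading `γρ β`, and Hölder's inequality gives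
`‖ρ H u‖₂ ≤ ‖ρ u‖_p ‖H‖_r`.

The simplices at distance `n` from `T` lie in a ball of radius comparable to `(n+1) γh^n diam T`, so
their total volume is at most a multiple of `(n+1)^d γh^(dn) |T|`. Hence `‖H‖_r` is bounded by a
multiple of `‖g‖_r` if `γh^d < β^r` (`exists_sum_volume_le`, `Mesh.sum_gmax_rpow_le`). The
hypothesis on the gradings leaves room for a `β` with `γh^(d/r) < β` and `γρ β < γ_max`. Finally `g
= (ρ A)^(p/r)` makes both `(ρ A g)²` and `g^r` equal to `(ρ A)^p`, and a division bounds `‖ρ A‖_p`;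
for `p = ∞`, `g` is the indicator of one simplex (`weightedStable_of_two_lt`). -/

namespace WeightedLp

/-! ### Null overlaps of simplices and piecewise constant functions -/

section Geometry

variable {d : ℕ}

lemma convex_simplex (s : Finset (Euc d)) : Convex ℝ (simplex s) := convex_convexHull ℝ _

lemma volume_simplex_ne_top (s : Finset (Euc d)) : volume (simplex s) ≠ ⊤ :=
  (isCompact_simplex s).measure_lt_top.ne

lemma isBounded_simplex (s : Finset (Euc d)) : Bornology.IsBounded (simplex s) :=
  (isCompact_simplex s).isBounded

lemma Triangulation.interior_simplex_nonempty (M : Triangulation d) {s : Finset (Euc d)}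
    (hs : s ∈ M.cells) : (interior (simplex s)).Nonempty := by
  rw [simplex, interior_convexHull_nonempty_iff_affineSpan_eq_top]
  have h := (M.affineIndependent s hs).affineSpan_eq_top_iff_card_eq_finrank_add_one
  have h2 := h.2 (by simp [M.card_eq s hs])
  simpa using h2

lemma Triangulation.volume_simplex_pos (M : Triangulation d) {s : Finset (Euc d)}
    (hs : s ∈ M.cells) : 0 < volume (simplex s) :=
  (isOpen_interior.measure_pos volume (M.interior_simplex_nonempty hs)).trans_le
    (measure_mono _root_.interior_subset)

lemma Triangulation.volume_simplex_ne_zero (M : Triangulation d) {s : Finset (Euc d)}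
    (hs : s ∈ M.cells) : volume (simplex s) ≠ 0 := (M.volume_simplex_pos hs).ne'

lemma ae_mem_interior_simplex (s : Finset (Euc d)) :
    ∀ᵐ x ∂volume.restrict (simplex s), x ∈ interior (simplex s) := by
  have h0 : volume (frontier (simplex s)) = 0 := (convex_simplex s).addHaar_frontier volume
  rw [ae_restrict_iff' (isCompact_simplex s).measurableSet]
  filter_upwards [measure_eq_zero_iff_ae_notMem.1 h0] with x hx hxs
  by_contra hc
  exact hx ⟨subset_closure hxs, hc⟩

/-- Some vertex of `s` is not a vertex of `t`. By affine independence it lies outside the affine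
span of the common vertices, which is therefore a proper subspace, hence null, and contains the
intersection. -/
lemma Triangulation.volume_inter_eq_zero (M : Triangulation d) {s t : Finset (Euc d)}
    (hs : s ∈ M.cells) (ht : t ∈ M.cells) (hne : s ≠ t) :
    volume (simplex s ∩ simplex t) = 0 := by
  have hst : ¬ s ⊆ t := fun h => hne (Finset.eq_of_subset_of_card_le h
    (by rw [M.card_eq s hs, M.card_eq t ht]))
  obtain ⟨x, hxs, hxt⟩ := Finset.not_subset.1 hst
  have hx : x ∉ affineSpan ℝ ((s : Set (Euc d)) ∩ t) := by
    have h := (M.affineIndependent s hs).notMem_affineSpan_sdiff ⟨x, hxs⟩ Set.univ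
    refine fun hc => h (affineSpan_mono ℝ ?_ hc)
    rintro y ⟨hys, hyt⟩
    refine ⟨⟨y, hys⟩, ⟨trivial, ?_⟩, rfl⟩
    rintro h
    have : y = x := congrArg Subtype.val h
    exact hxt (this ▸ hyt)
  have hne' : affineSpan ℝ ((s : Set (Euc d)) ∩ t) ≠ ⊤ := fun h => hx (h ▸ AffineSubspace.mem_top ℝ _ x)
  refine measure_mono_null ?_ (Measure.addHaar_affineSubspace volume _ hne')
  exact (M.inter_subset s hs t ht).trans (convexHull_subset_affineSpan _)

lemma Triangulation.aedisjoint (M : Triangulation d) :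
    Pairwise fun s t : {s // s ∈ M.cells} => AEDisjoint volume (simplex s.1) (simplex t.1) :=
  fun s t h => M.volume_inter_eq_zero s.2 t.2 (fun h' => h (Subtype.ext h'))

lemma Triangulation.ae_restrict_iff (M : Triangulation d) {P : Euc d → Prop} :
    (∀ᵐ x ∂volume.restrict (⋃ s : {s // s ∈ M.cells}, simplex s.1), P x) ↔
      ∀ s : {s // s ∈ M.cells}, ∀ᵐ x ∂volume.restrict (simplex s.1), P x := by
  rw [ae_restrict_iUnion_iff]

lemma Triangulation.closure_eq_iUnion (M : Triangulation d) :
    closure M.Ω = ⋃ s : {s // s ∈ M.cells}, simplex s.1 := by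
  rw [M.closure_eq, Set.iUnion_subtype]

/-- The union of the simplices is the closure of `Ω`, and it exceeds `Ω` only by points on frontiers
of simplices, which are null by convexity. -/
lemma Triangulation.restrict_domain (M : Triangulation d) :
    volume.restrict M.Ω = volume.restrict (⋃ s : {s // s ∈ M.cells}, simplex s.1) := by
  refine Measure.restrict_congr_set (Filter.EventuallyLE.antisymm ?_ ?_)
  · rw [← M.closure_eq_iUnion]
    exact subset_closure.eventuallyLE
  · have h : ∀ᵐ x ∂volume.restrict (⋃ s : {s // s ∈ M.cells}, simplex s.1), x ∈ M.Ω := by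
      rw [M.ae_restrict_iff]
      intro s
      filter_upwards [ae_mem_interior_simplex s.1] with x hx
      exact M.interior_subset s.1 s.2 hx
    have hm : MeasurableSet (⋃ s : {s // s ∈ M.cells}, simplex s.1) := by
      rw [← M.closure_eq_iUnion]
      exact isClosed_closure.measurableSet
    exact (ae_restrict_iff' hm).1 h

lemma Triangulation.ae_domain_iff (M : Triangulation d) {P : Euc d → Prop} :
    (∀ᵐ x ∂volume.restrict M.Ω, P x) ↔
      ∀ s : {s // s ∈ M.cells}, ∀ᵐ x ∂volume.restrict (simplex s.1), P x := by
  have h := M.restrict_domain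
  rw [h]
  exact M.ae_restrict_iff

lemma Triangulation.lintegral_domain (M : Triangulation d) (f : Euc d → ℝ≥0∞) :
    ∫⁻ x in M.Ω, f x = ∑ s : {s // s ∈ M.cells}, ∫⁻ x in simplex s.1, f x := by
  have hm : ∀ s : {s // s ∈ M.cells}, NullMeasurableSet (simplex s.1) volume := fun s =>
    (isCompact_simplex s.1).measurableSet.nullMeasurableSet
  have h := M.restrict_domain
  rw [h, lintegral_iUnion₀ hm M.aedisjoint, tsum_fintype]

instance Triangulation.ae_simplex_neBot (M : Triangulation d) (s : {s // s ∈ M.cells}) :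
    (ae (volume.restrict (simplex s.1))).NeBot := by
  rw [ae_neBot, Ne, Measure.restrict_eq_zero]
  exact M.volume_simplex_ne_zero s.2

/-- The piecewise constant function with given values on the simplices. -/
noncomputable def Triangulation.pw (M : Triangulation d) (w : {s // s ∈ M.cells} → ℝ≥0)
    (x : Euc d) : ℝ :=
  ∑ s, (interior (simplex s.1)).indicator (fun _ => (w s : ℝ)) x

lemma Triangulation.measurable_pw (M : Triangulation d) (w : {s // s ∈ M.cells} → ℝ≥0) :
    Measurable (M.pw w) :=
  Finset.measurable_fun_sum _ fun _ _ =>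
    measurable_const.indicator isOpen_interior.measurableSet

lemma Triangulation.pw_ae_eq (M : Triangulation d) (w : {s // s ∈ M.cells} → ℝ≥0)
    (s : {s // s ∈ M.cells}) : ∀ᵐ x ∂volume.restrict (simplex s.1), M.pw w x = w s := by
  have h : ∀ᵐ x ∂volume.restrict (simplex s.1), ∀ t : {s // s ∈ M.cells}, t ≠ s →
      x ∉ simplex t.1 := by
    rw [ae_all_iff]
    intro t
    by_cases hts : t = s
    · simp [hts]
    · have h0 := M.volume_inter_eq_zero s.2 t.2 (fun h' => hts (Subtype.ext h'.symm))
      rw [ae_restrict_iff' (isCompact_simplex s.1).measurableSet]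
      filter_upwards [measure_eq_zero_iff_ae_notMem.1 h0] with x hx hxs _ hxt
      exact hx ⟨hxs, hxt⟩
  filter_upwards [h, ae_mem_interior_simplex s.1] with x hx hxs
  rw [Triangulation.pw, Finset.sum_eq_single s, Set.indicator_of_mem hxs]
  · intro t _ hts
    exact Set.indicator_of_notMem (fun hc => hx t hts (_root_.interior_subset hc)) _
  · simp

lemma Triangulation.pw_mul_ae_eq (M : Triangulation d) (w g : {s // s ∈ M.cells} → ℝ≥0) :
    ∀ᵐ x ∂volume.restrict M.Ω, M.pw (fun s => w s * g s) x = M.pw w x * M.pw g x := by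
  rw [M.ae_domain_iff]
  intro s
  filter_upwards [M.pw_ae_eq w s, M.pw_ae_eq g s, M.pw_ae_eq (fun s => w s * g s) s]
    with x h1 h2 h3
  rw [h1, h2, h3]
  push_cast
  rfl

lemma Triangulation.memLp_pw (M : Triangulation d) (w : {s // s ∈ M.cells} → ℝ≥0) (p : ℝ≥0∞) :
    MemLp (M.pw w) p (volume.restrict M.Ω) := by
  refine MemLp.of_bound (M.measurable_pw w).aestronglyMeasurable (∑ s, (w s : ℝ)) ?_
  rw [M.ae_domain_iff]
  intro s
  filter_upwards [M.pw_ae_eq w s] with x hx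
  rw [hx, NNReal.norm_eq]
  exact Finset.single_le_sum (f := fun s => (w s : ℝ)) (fun t _ => (w t).2) (Finset.mem_univ s)

lemma Triangulation.lintegral_pw_mul (M : Triangulation d) (w : {s // s ∈ M.cells} → ℝ≥0)
    {r : ℝ} (hr : 0 ≤ r) (f : Euc d → ℝ) :
    ∫⁻ x in M.Ω, ‖M.pw w x * f x‖ₑ ^ r =
      ∑ s : {s // s ∈ M.cells}, (w s : ℝ≥0∞) ^ r * ∫⁻ x in simplex s.1, ‖f x‖ₑ ^ r := by
  rw [M.lintegral_domain]
  refine Finset.sum_congr rfl fun s _ => ?_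
  rw [← lintegral_const_mul' _ _ (ENNReal.rpow_ne_top_of_nonneg hr ENNReal.coe_ne_top)]
  refine lintegral_congr_ae ?_
  filter_upwards [M.pw_ae_eq w s] with x hx
  rw [hx, enorm_mul, ENNReal.mul_rpow_of_nonneg _ _ hr]
  simp

lemma Triangulation.eLpNorm_pw_mul_rpow (M : Triangulation d) (w : {s // s ∈ M.cells} → ℝ≥0)
    {p : ℝ≥0∞} (h0 : p ≠ 0) (ht : p ≠ ⊤) (f : Euc d → ℝ) :
    eLpNorm (fun x => M.pw w x * f x) p (volume.restrict M.Ω) ^ p.toReal =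
      ∑ s : {s // s ∈ M.cells}, (w s : ℝ≥0∞) ^ p.toReal *
        ∫⁻ x in simplex s.1, ‖f x‖ₑ ^ p.toReal := by
  rw [← M.lintegral_pw_mul w ENNReal.toReal_nonneg, eLpNorm_eq_lintegral_rpow_enorm_toReal h0 ht,
    ← ENNReal.rpow_mul, one_div_mul_cancel (ENNReal.toReal_pos h0 ht).ne', ENNReal.rpow_one]

lemma Triangulation.eLpNorm_pw_rpow (M : Triangulation d) (w : {s // s ∈ M.cells} → ℝ≥0)
    {p : ℝ≥0∞} (h0 : p ≠ 0) (ht : p ≠ ⊤) :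
    eLpNorm (M.pw w) p (volume.restrict M.Ω) ^ p.toReal =
      ∑ s : {s // s ∈ M.cells}, (w s : ℝ≥0∞) ^ p.toReal * volume (simplex s.1) := by
  simpa using M.eLpNorm_pw_mul_rpow w h0 ht (fun _ => 1)

end Geometry

/-! ### Inverse estimate for polynomials on shape regular simplices -/

section InverseEstimate

variable {d : ℕ}

lemma totalDegree_aeval_le {σ τ : Type*} [Fintype σ] (P : MvPolynomial σ ℝ)
    {f : σ → MvPolynomial τ ℝ} (hf : ∀ i, (f i).totalDegree ≤ 1) :
    (MvPolynomial.aeval f P).totalDegree ≤ P.totalDegree := by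
  rw [MvPolynomial.aeval_def, MvPolynomial.eval₂_eq']
  refine MvPolynomial.totalDegree_finsetSum_le fun m hm => ?_
  refine (MvPolynomial.totalDegree_mul _ _).trans ?_
  rw [MvPolynomial.algebraMap_eq, MvPolynomial.totalDegree_C, zero_add]
  refine (MvPolynomial.totalDegree_finsetProd _ _).trans ?_
  refine le_trans ?_ (MvPolynomial.le_totalDegree hm)
  rw [Finsupp.sum_fintype _ _ (fun _ => rfl)]
  refine Finset.sum_le_sum fun i _ => (MvPolynomial.totalDegree_pow _ _).trans ?_
  exact (Nat.mul_le_mul_left _ (hf i)).trans (mul_one _).le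

lemma continuous_eval_poly (P : MvPolynomial (Fin d) ℝ) :
    Continuous fun x : Euc d => MvPolynomial.eval (fun i => x i) P :=
  (MvPolynomial.continuous_eval P).comp (by fun_prop)

/-- Continuity turns "almost everywhere" into "everywhere" on the open ball, which contains a
product of infinite sets; only the zero polynomial vanishes there. -/
lemma eq_zero_of_ae_eq_zero_ball {P : MvPolynomial (Fin d) ℝ}
    (h : ∀ᵐ x ∂volume.restrict (Metric.closedBall (0 : Euc d) 1),
      MvPolynomial.eval (fun i => x i) P = 0) : P = 0 := by
  have h1 : ∀ᵐ x ∂volume.restrict (Metric.ball (0 : Euc d) 1),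
      MvPolynomial.eval (fun i => x i) P = 0 :=
    ae_restrict_of_ae_restrict_of_subset Metric.ball_subset_closedBall h
  have h2 : Set.EqOn (fun x : Euc d => MvPolynomial.eval (fun i => x i) P) (fun _ => 0)
      (Metric.ball 0 1) :=
    Measure.eqOn_open_of_ae_eq h1 Metric.isOpen_ball (continuous_eval_poly P).continuousOn
      continuousOn_const
  have h3 : IsOpen ((WithLp.toLp 2 : (Fin d → ℝ) → Euc d) ⁻¹' (Metric.ball 0 1)) :=
    Metric.isOpen_ball.preimage (PiLp.continuous_toLp 2 _)
  obtain ⟨ε, hε, hε'⟩ := Metric.isOpen_iff.1 h3 0 (by simp)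
  refine MvPolynomial.funext_set (fun _ => Metric.ball (0 : ℝ) ε) (fun i => ?_) fun x hx => ?_
  · rw [Real.ball_eq_Ioo]
    exact Set.Ioo_infinite (by linarith)
  · have hx' : WithLp.toLp 2 x ∈ Metric.ball (0 : Euc d) 1 := by
      refine hε' ?_
      rw [Metric.mem_ball, dist_pi_lt_iff hε]
      exact fun i => hx i trivial
    simpa using h2 hx'

/-- Polynomials of degree at most `K` form a finite-dimensional space that embeds into `L²` of the
unit ball, so restriction to the ball of radius `R` is bounded from the `L²`-norm to the maximum
norm. `C` is the square of its operator norm. -/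
lemma exists_sup_le_integral_unitBall (d K : ℕ) (R : ℝ) :
    ∃ C : ℝ, 0 ≤ C ∧ ∀ P : MvPolynomial (Fin d) ℝ, P.totalDegree ≤ K →
      ∀ y ∈ Metric.closedBall (0 : Euc d) R, MvPolynomial.eval (fun i => y i) P ^ 2 ≤
        C * ∫ x in Metric.closedBall (0 : Euc d) 1, MvPolynomial.eval (fun i => x i) P ^ 2 := by
  let μ := volume.restrict (Metric.closedBall (0 : Euc d) 1)
  let V := MvPolynomial.restrictTotalDegree (Fin d) ℝ K
  have hμ : IsFiniteMeasure μ := ⟨by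
    simpa [μ] using (isCompact_closedBall (0 : Euc d) 1).measure_lt_top⟩
  have hL : ∀ P : MvPolynomial (Fin d) ℝ,
      MemLp (fun x : Euc d => MvPolynomial.eval (fun i => x i) P) 2 μ := by
    intro P
    obtain ⟨C, hC⟩ := (isCompact_closedBall (0 : Euc d) 1).exists_bound_of_continuousOn
      (continuous_eval_poly P).continuousOn
    refine MemLp.of_bound (continuous_eval_poly P).aestronglyMeasurable C ?_
    exact (ae_restrict_iff' Metric.isClosed_closedBall.measurableSet).2 (.of_forall hC)
  let Θ : V →ₗ[ℝ] Lp ℝ 2 μ :=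
    { toFun := fun P => (hL P.1).toLp _
      map_add' := fun P Q => by
        rw [← MemLp.toLp_add]
        congr 1
        ext x
        simp
      map_smul' := fun c P => by
        simp only [RingHom.id_apply]
        rw [← MemLp.toLp_const_smul]
        congr 1
        ext x
        simp [MvPolynomial.smul_eval] }
  have hΘ : Function.Injective Θ := by
    rw [← LinearMap.ker_eq_bot, LinearMap.ker_eq_bot']
    intro P hP
    refine Subtype.ext (eq_zero_of_ae_eq_zero_ball ?_)
    have e1 := (hL P.1).coeFn_toLp
    have e2 : (hL P.1).toLp _ = 0 := hP
    rw [e2] at e1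
    filter_upwards [e1, Lp.coeFn_zero ℝ 2 μ] with x h1 h2
    rw [← h1, h2]
    rfl
  have : CompactSpace (Metric.closedBall (0 : Euc d) R) :=
    isCompact_iff_compactSpace.1 (isCompact_closedBall _ _)
  let E : V →ₗ[ℝ] C(Metric.closedBall (0 : Euc d) R, ℝ) :=
    { toFun := fun P => ⟨fun x => MvPolynomial.eval (fun i => x.1 i) P.1,
        (continuous_eval_poly P.1).comp continuous_subtype_val⟩
      map_add' := fun P Q => by
        ext x
        simp
      map_smul' := fun c P => by
        ext x
        simp [MvPolynomial.smul_eval] }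
  let e := LinearEquiv.ofInjective Θ hΘ
  let F := LinearMap.toContinuousLinearMap (E.comp e.symm.toLinearMap)
  refine ⟨‖F‖ ^ 2, by positivity, fun P hP y hy => ?_⟩
  let Q : V := ⟨P, (MvPolynomial.mem_restrictTotalDegree _ _ _).2 hP⟩
  have h1 : ‖F (e Q)‖ ≤ ‖F‖ * ‖e Q‖ := F.le_opNorm _
  have h2 : F (e Q) = E Q := by simp [F]
  have h3 : ‖E Q ⟨y, hy⟩‖ ≤ ‖E Q‖ := (E Q).norm_coe_le_norm _
  have h4 : ‖e Q‖ = ‖(hL P).toLp _‖ := rfl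
  have h5 : ‖(hL P).toLp _‖ ^ 2 = ∫ x, MvPolynomial.eval (fun i => x i) P ^ 2 ∂μ := by
    rw [← real_inner_self_eq_norm_sq, L2.inner_def]
    refine integral_congr_ae ?_
    filter_upwards [(hL P).coeFn_toLp] with x hx
    simp [hx]
  rw [← h5, ← mul_pow, ← h4]
  refine sq_le_sq' ?_ ?_
  · exact (abs_le.1 (h3.trans (h2 ▸ h1))).1
  · exact (abs_le.1 (h3.trans (h2 ▸ h1))).2

lemma setIntegral_closedBall_eq (f : Euc d → ℝ) (x₀ : Euc d) {r : ℝ} (hr : 0 < r) :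
    ∫ x in Metric.closedBall x₀ r, f x =
      r ^ d * ∫ z in Metric.closedBall (0 : Euc d) 1, f (x₀ + r • z) := by
  have h1 : ∫ x in Metric.closedBall x₀ r, f x =
      ∫ z in Metric.closedBall (0 : Euc d) r, f (x₀ + z) := by
    have h := (measurePreserving_add_left (volume : Measure (Euc d)) x₀).setIntegral_preimage_emb
      (measurableEmbedding_addLeft x₀) f (Metric.closedBall x₀ r)
    rw [← h]
    congr 2
    ext z
    simp
  rw [h1, Measure.setIntegral_comp_smul_of_pos volume (fun z => f (x₀ + z)) _ hr,
    smul_closedBall _ _ zero_le_one]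
  simp [abs_of_pos hr]
  field_simp

/-- Inverse estimate for polynomials on balls of arbitrary position and size. -/
lemma exists_sup_le_integral_ball (d K : ℕ) (R : ℝ) :
    ∃ C : ℝ, 0 ≤ C ∧ ∀ P : MvPolynomial (Fin d) ℝ, P.totalDegree ≤ K →
      ∀ (x₀ : Euc d) (r : ℝ), 0 < r → ∀ y ∈ Metric.closedBall x₀ (R * r),
        MvPolynomial.eval (fun i => y i) P ^ 2 * r ^ d ≤
          C * ∫ x in Metric.closedBall x₀ r, MvPolynomial.eval (fun i => x i) P ^ 2 := by
  obtain ⟨C, hC0, hC⟩ := exists_sup_le_integral_unitBall d K R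
  refine ⟨C, hC0, fun P hP x₀ r hr y hy => ?_⟩
  -- The affine substitution `z ↦ x₀ + r z` reduces to the unit ball and does not raise the degree.
  let f : Fin d → MvPolynomial (Fin d) ℝ := fun i =>
    MvPolynomial.C (x₀ i) + MvPolynomial.C r * MvPolynomial.X i
  let Q := MvPolynomial.aeval f P
  have hf : ∀ i, (f i).totalDegree ≤ 1 := fun i => by
    refine (MvPolynomial.totalDegree_add _ _).trans (max_le (by simp) ?_)
    refine (MvPolynomial.totalDegree_mul _ _).trans ?_
    simp
  have hQ : ∀ z : Euc d, MvPolynomial.eval (fun i => z i) Q =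
      MvPolynomial.eval (fun i => (x₀ + r • z) i) P := by
    intro z
    rw [← MvPolynomial.coe_aeval_eq_eval, ← MvPolynomial.coe_aeval_eq_eval]
    change MvPolynomial.aeval _ (MvPolynomial.aeval f P) = MvPolynomial.aeval _ P
    rw [← AlgHom.comp_apply, MvPolynomial.comp_aeval]
    congr 2
    ext i
    simp [f]
  have h1 := hC Q ((totalDegree_aeval_le P hf).trans hP) (r⁻¹ • (y - x₀)) (by
    rw [mem_closedBall_zero_iff, norm_smul, norm_inv, Real.norm_of_nonneg hr.le,
      inv_mul_le_iff₀ hr, mul_comm]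
    simpa [dist_eq_norm] using hy)
  simp only [hQ] at h1
  rw [smul_inv_smul₀ hr.ne', add_sub_cancel] at h1
  rw [setIntegral_closedBall_eq _ _ hr]
  calc _ ≤ (C * ∫ z in Metric.closedBall (0 : Euc d) 1,
        MvPolynomial.eval (fun i => (x₀ + r • z) i) P ^ 2) * r ^ d := by gcongr
    _ = _ := by ring

lemma Triangulation.ShapeRegular.exists_ball {M : Triangulation d} {χ : ℝ}
    (hM : M.ShapeRegular χ) (s : {s // s ∈ M.cells}) :
    ∃ (x : Euc d) (r : ℝ), 0 < r ∧ Metric.closedBall x r ⊆ simplex s.1 ∧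
      simplex s.1 ⊆ Metric.closedBall x (2 * χ * r) := by
  obtain ⟨x, r, hr, h1, h2⟩ := hM s.1 s.2
  refine ⟨x, r, hr, h1, fun y hy => ?_⟩
  rw [Metric.mem_closedBall]
  refine (Metric.dist_le_diam_of_mem (isBounded_simplex _) hy
    (h1 (Metric.mem_closedBall_self hr.le))).trans (h2.trans (by linarith))

lemma volume_closedBall_eq (x : Euc d) {r : ℝ} (hr : 0 ≤ r) :
    volume (Metric.closedBall x r) =
      ENNReal.ofReal (r ^ d) * volume (Metric.closedBall (0 : Euc d) 1) := by
  rw [Measure.addHaar_closedBall' volume x hr, finrank_euclideanSpace_fin]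

/-- Inverse estimate between the maximum norm and the `L²`-norm on a simplex. -/
lemma exists_inverse_estimate (d K : ℕ) (χ : ℝ) :
    ∃ C : ℝ≥0, ∀ M : Triangulation d, M.ShapeRegular χ → ∀ v, M.PiecewisePoly K v →
      ∃ A : {s // s ∈ M.cells} → ℝ≥0, ∀ s,
        (∀ᵐ x ∂volume.restrict (simplex s.1), ‖v x‖ₑ ≤ A s) ∧
        (A s : ℝ≥0∞) ^ 2 * volume (simplex s.1) ≤ C * ∫⁻ x in simplex s.1, ‖v x‖ₑ ^ 2 := by
  obtain ⟨C, hC0, hC⟩ := exists_sup_le_integral_ball d K (2 * χ)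
  let b₀ := volume (Metric.closedBall (0 : Euc d) 1)
  have hb : b₀ ≠ ⊤ := (isCompact_closedBall _ _).measure_lt_top.ne
  -- `C` compares the maximum on the outer ball with the integral over the inner one; `(2χ)^d b₀`
  -- bounds the volume of the simplex in units of `r ^ d`.
  refine ⟨C.toNNReal * ((2 * χ) ^ d).toNNReal * b₀.toNNReal, fun M hM v hv => ?_⟩
  suffices h : ∀ s : {s // s ∈ M.cells}, ∃ A : ℝ≥0,
      (∀ᵐ x ∂volume.restrict (simplex s.1), ‖v x‖ₑ ≤ A) ∧
        (A : ℝ≥0∞) ^ 2 * volume (simplex s.1) ≤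
          (C.toNNReal * ((2 * χ) ^ d).toNNReal * b₀.toNNReal : ℝ≥0) *
            ∫⁻ x in simplex s.1, ‖v x‖ₑ ^ 2 by
    choose A hA using h
    exact ⟨A, hA⟩
  intro s
  obtain ⟨x₀, r, hr, hin, hout⟩ := hM.exists_ball s
  obtain ⟨P, hP, hvP⟩ := hv s.1 s.2
  have hχ : 0 ≤ 2 * χ := by
    have := hout (hin (Metric.mem_closedBall_self hr.le))
    rw [Metric.mem_closedBall, dist_self] at this
    exact nonneg_of_mul_nonneg_left this hr
  let I := ∫ x in Metric.closedBall x₀ r, MvPolynomial.eval (fun i => x i) P ^ 2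
  have hI : 0 ≤ I := integral_nonneg fun x => sq_nonneg _
  have hrd : 0 < r ^ d := pow_pos hr d
  let a : ℝ := C * I / r ^ d
  have ha : 0 ≤ a := by positivity
  refine ⟨(Real.sqrt a).toNNReal, ?_, ?_⟩
  · filter_upwards [hvP, ae_restrict_mem (isCompact_simplex s.1).measurableSet] with x hx hxs
    rw [hx, ← ofReal_norm]
    refine ENNReal.ofReal_le_ofReal ?_
    rw [Real.norm_eq_abs]
    refine Real.abs_le_sqrt ?_
    rw [le_div_iff₀ hrd]
    exact hC P hP x₀ r hr x (hout hxs)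
  · have h1 : volume (simplex s.1) ≤ ENNReal.ofReal ((2 * χ) ^ d * r ^ d) * b₀ := by
      refine (measure_mono hout).trans_eq ?_
      rw [volume_closedBall_eq _ (by positivity), mul_pow]
    have h2 : ENNReal.ofReal I ≤ ∫⁻ x in simplex s.1, ‖v x‖ₑ ^ 2 := by
      have hint : IntegrableOn (fun x : Euc d => MvPolynomial.eval (fun i => x i) P ^ 2)
          (Metric.closedBall x₀ r) :=
        ((continuous_eval_poly P).pow 2).continuousOn.integrableOn_compact (isCompact_closedBall _ _)
      rw [ofReal_integral_eq_lintegral_ofReal hint (.of_forall fun x => sq_nonneg _)]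
      refine (lintegral_mono_set hin).trans_eq ?_
      refine lintegral_congr_ae ?_
      filter_upwards [hvP] with x hx
      rw [hx, ← ofReal_norm, ← ENNReal.ofReal_pow (norm_nonneg _), Real.norm_eq_abs, sq_abs]
    have h3 : ((Real.sqrt a).toNNReal : ℝ≥0∞) ^ 2 = ENNReal.ofReal a := by
      change ENNReal.ofReal _ ^ 2 = _
      rw [← ENNReal.ofReal_pow (Real.sqrt_nonneg _), Real.sq_sqrt ha]
    have h4 : ENNReal.ofReal a * ENNReal.ofReal ((2 * χ) ^ d * r ^ d) =
        ENNReal.ofReal C * ENNReal.ofReal ((2 * χ) ^ d) * ENNReal.ofReal I := by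
      rw [← ENNReal.ofReal_mul ha, ← ENNReal.ofReal_mul hC0, ← ENNReal.ofReal_mul (by positivity)]
      congr 1
      simp only [a]
      field_simp
    rw [h3]
    calc ENNReal.ofReal a * volume (simplex s.1)
        ≤ ENNReal.ofReal a * (ENNReal.ofReal ((2 * χ) ^ d * r ^ d) * b₀) := by gcongr
      _ = ENNReal.ofReal C * ENNReal.ofReal ((2 * χ) ^ d) * b₀ * ENNReal.ofReal I := by
        rw [← mul_assoc, h4]
        ring
      _ ≤ ENNReal.ofReal C * ENNReal.ofReal ((2 * χ) ^ d) * b₀ *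
          ∫⁻ x in simplex s.1, ‖v x‖ₑ ^ 2 := by gcongr
      _ = _ := by
        push_cast
        rw [ENNReal.coe_toNNReal hb]
        rfl

end InverseEstimate

/-! ### Reduction to piecewise constant weights -/

section Weights

variable {d : ℕ}

/-- A function on the simplices that grows at most by the factor `γ` between neighbours. -/
def Mesh.Graded (M : Mesh d) (w : {s // s ∈ M.cells} → ℝ≥0) (γ : ℝ≥0) : Prop :=
  ∀ s t, M.nbr.Adj s t → w t ≤ γ * w s

lemma Mesh.Graded.mul {M : Mesh d} {w g : {s // s ∈ M.cells} → ℝ≥0} {γ β : ℝ≥0}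
    (hw : M.Graded w γ) (hg : M.Graded g β) : M.Graded (fun s => w s * g s) (γ * β) :=
  fun s t h => (mul_le_mul' (hw s t h) (hg s t h)).trans_eq (mul_mul_mul_comm _ _ _ _)

lemma Mesh.Graded.inv {M : Mesh d} {w : {s // s ∈ M.cells} → ℝ≥0} {γ : ℝ≥0}
    (hw : M.Graded w γ) (hpos : ∀ s, 0 < w s) : M.Graded (fun s => (w s)⁻¹) γ := by
  intro s t h
  have h1 := hw t s h.symm
  rw [← div_eq_mul_inv, le_div_iff₀ (hpos s), inv_mul_le_iff₀ (hpos t), mul_comm]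
  exact h1

lemma supOn_pw (M : Triangulation d) (w : {s // s ∈ M.cells} → ℝ≥0) (s : {s // s ∈ M.cells}) :
    supOn s.1 (M.pw w) = w s := by
  have h : (fun x => ENNReal.ofReal (M.pw w x)) =ᵐ[volume.restrict (simplex s.1)]
      fun _ => (w s : ℝ≥0∞) := by
    filter_upwards [M.pw_ae_eq w s] with x hx
    rw [hx, ENNReal.ofReal_coe_nnreal]
  rw [supOn, essSup_congr_ae h, essSup_const]
  exact ae_neBot.1 (M.ae_simplex_neBot s)

lemma infOn_pw (M : Triangulation d) (w : {s // s ∈ M.cells} → ℝ≥0) (s : {s // s ∈ M.cells}) :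
    infOn s.1 (M.pw w) = w s := by
  have h : (fun x => ENNReal.ofReal (M.pw w x)) =ᵐ[volume.restrict (simplex s.1)]
      fun _ => (w s : ℝ≥0∞) := by
    filter_upwards [M.pw_ae_eq w s] with x hx
    rw [hx, ENNReal.ofReal_coe_nnreal]
  rw [infOn, essInf_congr_ae h, essInf_const]
  exact ae_neBot.1 (M.ae_simplex_neBot s)

lemma Mesh.Graded.isWeight_pw {M : Mesh d} {w : {s // s ∈ M.cells} → ℝ≥0} {γ : ℝ≥0}
    (hw : M.Graded w γ) (hγ : 1 ≤ γ) (hpos : ∀ s, 0 < w s) : M.IsWeight (M.pw w) γ := by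
  have hst : ∀ s t, M.δ s t = 1 → (w t : ℝ≥0∞) ≤ γ * w s := fun s t h => by
    exact_mod_cast hw s t (SimpleGraph.dist_eq_one_iff_adj.1 h)
  refine ⟨by exact_mod_cast hγ, (M.memLp_pw w 1).integrable le_rfl, ?_, fun s hs => ?_,
    fun s t h => ?_, fun s t h => ?_⟩
  · rw [M.ae_domain_iff]
    intro s
    filter_upwards [M.pw_ae_eq w s] with x hx
    rw [hx]
    exact_mod_cast hpos s
  · rw [supOn_pw M.toTriangulation w ⟨s, hs⟩, infOn_pw M.toTriangulation w ⟨s, hs⟩,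
      ENNReal.ofReal_coe_nnreal]
    exact_mod_cast le_mul_of_one_le_left (w ⟨s, hs⟩).2 hγ
  · rw [supOn_pw M.toTriangulation w, supOn_pw M.toTriangulation w, ENNReal.ofReal_coe_nnreal]
    exact hst s t h
  · rw [infOn_pw M.toTriangulation w, infOn_pw M.toTriangulation w, ENNReal.ofReal_coe_nnreal]
    exact hst s t h

lemma infOn_le_supOn (M : Triangulation d) (s : {s // s ∈ M.cells}) (ρ : Euc d → ℝ) :
    infOn s.1 ρ ≤ supOn s.1 ρ := by
  have := M.ae_simplex_neBot s
  exact Filter.liminf_le_limsup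

/-- A vanishing infimum would force the supremum to vanish by the grading inside the simplex,
against positivity almost everywhere. -/
lemma Mesh.IsWeight.infOn_ne_zero {M : Mesh d} {ρ : Euc d → ℝ} {γ : ℝ} (h : M.IsWeight ρ γ)
    (s : {s // s ∈ M.cells}) : infOn s.1 ρ ≠ 0 := by
  intro h0
  have h1 := h.sup_le_inf s.1 s.2
  rw [h0, mul_zero] at h1
  have h2 : ∀ᵐ x ∂volume.restrict (simplex s.1), ENNReal.ofReal (ρ x) ≤ supOn s.1 ρ :=
    ae_le_essSup
  have h3 := M.ae_domain_iff.1 h.pos s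
  have := M.ae_simplex_neBot s
  obtain ⟨x, hx, hx'⟩ := (h2.and h3).exists
  exact (ENNReal.ofReal_pos.2 hx').not_ge (hx.trans h1)

lemma infOn_ne_top (M : Triangulation d) (s : {s // s ∈ M.cells}) (ρ : Euc d → ℝ) :
    infOn s.1 ρ ≠ ⊤ := by
  intro h0
  have h2 : ∀ᵐ x ∂volume.restrict (simplex s.1), infOn s.1 ρ ≤ ENNReal.ofReal (ρ x) :=
    ae_essInf_le
  have := M.ae_simplex_neBot s
  obtain ⟨x, hx⟩ := h2.exists
  rw [h0] at hx
  exact ENNReal.ofReal_ne_top (top_le_iff.1 hx)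

/-- The essential infimum of a weight over a simplex as a number. -/
noncomputable def Mesh.cellInf (M : Mesh d) (ρ : Euc d → ℝ) (s : {s // s ∈ M.cells}) : ℝ≥0 :=
  (infOn s.1 ρ).toNNReal

lemma Mesh.coe_cellInf (M : Mesh d) (ρ : Euc d → ℝ) (s : {s // s ∈ M.cells}) :
    (M.cellInf ρ s : ℝ≥0∞) = infOn s.1 ρ :=
  ENNReal.coe_toNNReal (infOn_ne_top M.toTriangulation s ρ)

lemma Mesh.IsWeight.cellInf_pos {M : Mesh d} {ρ : Euc d → ℝ} {γ : ℝ} (h : M.IsWeight ρ γ)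
    (s : {s // s ∈ M.cells}) : 0 < M.cellInf ρ s :=
  ENNReal.toNNReal_pos (h.infOn_ne_zero s) (infOn_ne_top M.toTriangulation s ρ)

lemma Mesh.IsWeight.graded_cellInf {M : Mesh d} {ρ : Euc d → ℝ} {γ : ℝ} (h : M.IsWeight ρ γ) :
    M.Graded (M.cellInf ρ) γ.toNNReal := by
  intro s t hst
  have h1 := h.inf_le_inf s t (SimpleGraph.dist_eq_one_iff_adj.2 hst)
  rw [← M.coe_cellInf, ← M.coe_cellInf] at h1
  have h2 : (M.cellInf ρ t : ℝ≥0∞) ≤ (γ.toNNReal : ℝ≥0∞) * M.cellInf ρ s := h1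
  exact_mod_cast h2

lemma Mesh.IsWeight.enorm_pw_le {M : Mesh d} {ρ : Euc d → ℝ} {γ : ℝ} (h : M.IsWeight ρ γ) :
    ∀ᵐ x ∂volume.restrict M.Ω, ‖M.pw (M.cellInf ρ) x‖ₑ ≤ ‖ρ x‖ₑ ∧
      ‖ρ x‖ₑ ≤ γ.toNNReal * ‖M.pw (M.cellInf ρ) x‖ₑ := by
  rw [M.ae_domain_iff]
  intro s
  have h2 : ∀ᵐ x ∂volume.restrict (simplex s.1), infOn s.1 ρ ≤ ENNReal.ofReal (ρ x) :=
    ae_essInf_le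
  have h3 : ∀ᵐ x ∂volume.restrict (simplex s.1), ENNReal.ofReal (ρ x) ≤ supOn s.1 ρ :=
    ae_le_essSup
  filter_upwards [h2, h3, M.pw_ae_eq (M.cellInf ρ) s, M.ae_domain_iff.1 h.pos s]
    with x h2 h3 h4 h5
  have h6 : ‖(M.cellInf ρ s : ℝ)‖ₑ = infOn s.1 ρ := by
    rw [← M.coe_cellInf]
    simp
  rw [h4, h6, Real.enorm_of_nonneg h5.le]
  exact ⟨h2, h3.trans (h.sup_le_inf s.1 s.2)⟩

/-- A weight and its infima over the simplices differ pointwise by at most the factor `γ`, which is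
paid only on the side of `Qu`. -/
lemma Mesh.IsWeight.weightedStable_of_cellInf {M : Mesh d} {ρ : Euc d → ℝ} {γ : ℝ}
    (h : M.IsWeight ρ γ) {K : ℕ} {p : ℝ≥0∞} {C : ℝ≥0}
    (hC : M.WeightedStable K p (M.pw (M.cellInf ρ)) C) :
    M.WeightedStable K p ρ (γ.toNNReal * C) := by
  intro u hu
  have h1 : eLpNorm (fun x => ρ x * M.l2Proj K u x) p (volume.restrict M.Ω) ≤
      γ.toNNReal *
        eLpNorm (fun x => M.pw (M.cellInf ρ) x * M.l2Proj K u x) p (volume.restrict M.Ω) := by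
    refine (eLpNorm_le_nnreal_smul_eLpNorm_of_ae_le_mul' ?_ p)
    filter_upwards [h.enorm_pw_le] with x hx
    rw [enorm_mul, enorm_mul, ← mul_assoc]
    exact mul_le_mul_left hx.2 _
  have h2 : eLpNorm (fun x => M.pw (M.cellInf ρ) x * u x) p (volume.restrict M.Ω) ≤
      eLpNorm (fun x => ρ x * u x) p (volume.restrict M.Ω) := by
    refine eLpNorm_mono_enorm_ae ?_
    filter_upwards [h.enorm_pw_le] with x hx
    rw [enorm_mul, enorm_mul]
    exact mul_le_mul_left hx.1 _
  refine h1.trans ?_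
  push_cast
  rw [mul_assoc]
  exact mul_le_mul_right ((hC u hu).trans (mul_le_mul_right h2 _)) _

end Weights

/-! ### Exponential growth of volume with the distance -/

section Growth

variable {d : ℕ}

/-- A chain of length `n` has `n + 1` simplices, consecutive ones share a point, and each has
diameter at most `κ γ^n m s`. -/
lemma dist_le_of_walk {M : Mesh d} {m : {s // s ∈ M.cells} → ℝ≥0} {γ κ : ℝ≥0} (hγ : 1 ≤ γ)
    (hm : M.Graded m γ) (hκ : ∀ s, Metric.diam (simplex s.1) ≤ κ * m s)
    {s t : {s // s ∈ M.cells}} (p : M.nbr.Walk s t) :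
    ∀ x ∈ simplex s.1, ∀ y ∈ simplex t.1,
      dist x y ≤ ((p.length + 1 : ℕ) * (κ * γ ^ p.length) * m s : ℝ≥0) := by
  induction p with
  | nil =>
    intro x hx y hy
    refine (Metric.dist_le_diam_of_mem (isBounded_simplex _) hx hy).trans ((hκ _).trans ?_)
    simp
  | @cons a b c hab p ih =>
    intro x hx y hy
    obtain ⟨z, hz1, hz2⟩ := M.inter_nonempty a b hab
    have h1 := (Metric.dist_le_diam_of_mem (isBounded_simplex _) hx hz1).trans (hκ a)
    have h2 := ih z hz2 y hy
    refine (dist_triangle x z y).trans ((add_le_add h1 h2).trans ?_)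
    norm_cast
    rw [SimpleGraph.Walk.length_cons]
    have h3 : κ * m a ≤ κ * γ ^ (p.length + 1) * m a := by
      gcongr
      exact le_mul_of_one_le_right' (one_le_pow₀ hγ)
    have h4 : ((p.length + 1 : ℕ) : ℝ≥0) * (κ * γ ^ p.length) * m b ≤
        ((p.length + 1 : ℕ) : ℝ≥0) * (κ * γ ^ p.length) * (γ * m a) := by
      gcongr
      exact hm a b hab
    refine (add_le_add h3 h4).trans_eq ?_
    push_cast
    ring

lemma sum_volume_le {M : Triangulation d} (F : Finset {s // s ∈ M.cells}) {B : Set (Euc d)}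
    (hF : ∀ s ∈ F, simplex s.1 ⊆ B) : ∑ s ∈ F, volume (simplex s.1) ≤ volume B := by
  rw [← measure_biUnion_finset₀ (fun s _ t _ h => M.aedisjoint h)
    (fun s _ => (isCompact_simplex s.1).measurableSet.nullMeasurableSet)]
  exact measure_mono (Set.iUnion₂_subset hF)

/-- The volume of the simplices at a given distance grows at most exponentially. -/
lemma sum_volume_dist_eq_le {M : Mesh d} {χ : ℝ} (hM : M.ShapeRegular χ)
    {m : {s // s ∈ M.cells} → ℝ≥0} {γ κ : ℝ≥0} (hγ : 1 ≤ γ)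
    (hm : M.Graded m γ) (hκ : ∀ s, Metric.diam (simplex s.1) ≤ κ * m s)
    (hκ' : ∀ s, m s ≤ κ * Metric.diam (simplex s.1)) (s : {s // s ∈ M.cells}) (n : ℕ) :
    ∑ t with M.δ t s = n, volume (simplex t.1) ≤
      (((n + 1 : ℕ) * (κ ^ 2 * γ ^ n) * (2 * χ.toNNReal)) ^ d : ℝ≥0) * volume (simplex s.1) := by
  obtain ⟨x, r, hr, h1, h2⟩ := hM s.1 s.2
  have hd : Metric.diam (simplex s.1) ≤ 2 * χ.toNNReal * r := by
    refine h2.trans ?_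
    have := mul_le_mul_of_nonneg_right (Real.le_coe_toNNReal χ) (by linarith : 0 ≤ 2 * r)
    linarith
  -- One `κ` passes from diameters to `m` along the chain, the other from `m s` back to the diameter
  -- of `s`, which is at most `2χ r`. Comparison with the inscribed ball then gives `D ^ d`.
  let D : ℝ≥0 := (n + 1 : ℕ) * (κ ^ 2 * γ ^ n) * (2 * χ.toNNReal)
  have hsub : ∀ t ∈ Finset.univ.filter (fun t => M.δ t s = n),
      simplex t.1 ⊆ Metric.closedBall x (D * r) := by
    intro t ht y hy
    have hst : M.nbr.dist s t = n := by
      rw [SimpleGraph.dist_comm]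
      exact (Finset.mem_filter.1 ht).2
    obtain ⟨p, hp⟩ := M.nbr_connected.exists_walk_length_eq_dist s t
    have h3 := dist_le_of_walk hγ hm hκ p x (h1 (Metric.mem_closedBall_self hr.le)) y hy
    rw [hp, hst] at h3
    rw [Metric.mem_closedBall, dist_comm]
    refine h3.trans ?_
    have h4 : (m s : ℝ) ≤ κ * (2 * χ.toNNReal * r) :=
      (hκ' s).trans (mul_le_mul_of_nonneg_left hd κ.2)
    push_cast
    have h5 := mul_le_mul_of_nonneg_left h4
      (by positivity : (0 : ℝ) ≤ ((n : ℝ) + 1) * (κ * γ ^ n))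
    push_cast [D]
    refine h5.trans_eq ?_
    ring
  refine (sum_volume_le _ hsub).trans ?_
  rw [volume_closedBall_eq _ (by positivity), mul_pow, ENNReal.ofReal_mul (by positivity), mul_assoc,
    ← volume_closedBall_eq x hr.le]
  have h6 : ENNReal.ofReal ((D : ℝ) ^ d) = (D ^ d : ℝ≥0) := by
    rw [← NNReal.coe_pow, ENNReal.ofReal_coe_nnreal]
  rw [h6]
  gcongr

lemma NNReal.summable_succ_pow_mul_geometric (d : ℕ) {a : ℝ≥0} (ha : a < 1) :
    Summable fun n : ℕ => ((n + 1 : ℕ) : ℝ≥0) ^ d * a ^ (n + 1) := by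
  have ha' : ‖(a : ℝ)‖ < 1 := by
    rw [NNReal.norm_eq]
    exact_mod_cast ha
  have h1 := summable_pow_mul_geometric_of_norm_lt_one d ha'
  have h2 := (summable_nat_add_iff 1).2 h1
  rw [← NNReal.summable_coe]
  refine h2.congr fun n => ?_
  push_cast
  rfl

lemma summable_nat_mul_geometric (d : ℕ) {γ κ q : ℝ≥0} (b : ℝ≥0) (hq : γ ^ d * q < 1) :
    Summable fun n : ℕ => q ^ n * ((n + 1 : ℕ) * (κ * γ ^ n) * b) ^ d := by
  have h3 := NNReal.summable_succ_pow_mul_geometric d hq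
  have h5 : ∀ n : ℕ, q ^ n * ((n + 1 : ℕ) * (κ * γ ^ n) * b) ^ d =
      (κ * b) ^ d * (((n + 1 : ℕ) : ℝ≥0) ^ d * (γ ^ d * q) ^ n) := fun n => by
    rw [mul_pow, mul_pow, mul_pow, mul_pow, mul_pow, ← pow_mul, ← pow_mul, mul_comm d n]
    ring
  simp_rw [h5]
  refine Summable.mul_left _ ?_
  -- The known series carries the exponent `n + 1`; dropping one power requires division by the
  -- ratio. For ratio `0` only the term `n = 0` survives.
  rcases eq_or_ne (γ ^ d * q) 0 with h0 | h0
  · refine summable_of_ne_finset_zero (s := {0}) fun n hn => ?_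
    have hn0 : n ≠ 0 := by simpa using hn
    rw [h0, zero_pow hn0, mul_zero]
  · refine Summable.congr (h3.mul_left (γ ^ d * q)⁻¹) fun n => ?_
    rw [pow_succ', mul_left_comm, inv_mul_cancel_left₀ h0]

/-- The weighted volume of all simplices is controlled by that of a single one if the weight decays
fast enough with the distance. -/
lemma exists_sum_volume_le (d : ℕ) (χ : ℝ) {γ κ q : ℝ≥0} (hγ : 1 ≤ γ) (hq : γ ^ d * q < 1) :
    ∃ S : ℝ≥0, ∀ M : Mesh d, M.ShapeRegular χ → ∀ m : {s // s ∈ M.cells} → ℝ≥0,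
      M.Graded m γ → (∀ s, Metric.diam (simplex s.1) ≤ κ * m s) →
      (∀ s, m s ≤ κ * Metric.diam (simplex s.1)) → ∀ s,
      ∑ t, (q : ℝ≥0∞) ^ M.δ t s * volume (simplex t.1) ≤ S * volume (simplex s.1) := by
  let c : ℕ → ℝ≥0 := fun n => q ^ n * ((n + 1 : ℕ) * (κ ^ 2 * γ ^ n) * (2 * χ.toNNReal)) ^ d
  have hc : Summable c := summable_nat_mul_geometric d (2 * χ.toNNReal) hq
  refine ⟨∑' n, c n, fun M hM m hm hκ hκ' s => ?_⟩
  -- Inserting a sum over all distances allows the simplices to be grouped into shells around `s`.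
  have h1 : ∀ t, (q : ℝ≥0∞) ^ M.δ t s * volume (simplex t.1) =
      ∑' n, if M.δ t s = n then (q : ℝ≥0∞) ^ n * volume (simplex t.1) else 0 := fun t => by
    rw [tsum_eq_single (M.δ t s)]
    · simp
    · intro n hn
      simp [hn.symm]
  simp_rw [h1]
  rw [← Summable.tsum_finsetSum (fun _ _ => ENNReal.summable), ENNReal.coe_tsum hc,
    ← ENNReal.tsum_mul_right]
  refine ENNReal.tsum_le_tsum fun n => ?_
  rw [← Finset.sum_filter, ← Finset.mul_sum]
  simp only [c]
  rw [ENNReal.coe_mul, mul_assoc, ENNReal.coe_pow]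
  gcongr
  exact sum_volume_dist_eq_le hM hγ hm hκ hκ' s n

end Growth

/-! ### The graded majorant and its `L^r`-bound -/

section MaximalFunction

variable {d : ℕ}

/-- The least majorant of `g` that grows at most by the factor `β` between neighbours. -/
noncomputable def Mesh.gmax (M : Mesh d) (β : ℝ≥0) (g : {s // s ∈ M.cells} → ℝ≥0)
    (s : {s // s ∈ M.cells}) : ℝ≥0 :=
  Finset.univ.sup fun t => β⁻¹ ^ M.δ s t * g t

lemma Mesh.le_gmax_of_mul (M : Mesh d) (β : ℝ≥0) (g : {s // s ∈ M.cells} → ℝ≥0)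
    (s t : {s // s ∈ M.cells}) : β⁻¹ ^ M.δ s t * g t ≤ M.gmax β g s :=
  Finset.le_sup (f := fun t => β⁻¹ ^ M.δ s t * g t) (Finset.mem_univ t)

lemma Mesh.le_gmax (M : Mesh d) (β : ℝ≥0) (g : {s // s ∈ M.cells} → ℝ≥0)
    (s : {s // s ∈ M.cells}) : g s ≤ M.gmax β g s := by
  simpa [Mesh.δ] using M.le_gmax_of_mul β g s s

lemma Mesh.gmax_pos (M : Mesh d) {β : ℝ≥0} (hβ : 1 ≤ β) {g : {s // s ∈ M.cells} → ℝ≥0}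
    (hg : ∃ t, 0 < g t) (s : {s // s ∈ M.cells}) : 0 < M.gmax β g s := by
  obtain ⟨t, ht⟩ := hg
  refine lt_of_lt_of_le ?_ (M.le_gmax_of_mul β g s t)
  have : 0 < β := zero_lt_one.trans_le hβ
  positivity

/-- By the triangle inequality, passing to a neighbour changes `δ` by at most one, which costs one
factor `β`. -/
lemma Mesh.graded_gmax (M : Mesh d) {β : ℝ≥0} (hβ : 1 ≤ β) (g : {s // s ∈ M.cells} → ℝ≥0) :
    M.Graded (M.gmax β g) β := by
  intro s t hst
  refine Finset.sup_le fun v _ => ?_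
  have h1 : M.δ s v ≤ M.δ t v + 1 := by
    have h2 := M.nbr_connected.dist_triangle (u := s) (v := t) (w := v)
    rw [SimpleGraph.dist_eq_one_iff_adj.2 hst, add_comm] at h2
    exact h2
  have hβ0 : β ≠ 0 := (zero_lt_one.trans_le hβ).ne'
  have h3 : β⁻¹ ^ (M.δ t v + 1) ≤ β⁻¹ ^ M.δ s v :=
    pow_le_pow_of_le_one zero_le (inv_le_one_of_one_le₀ hβ) h1
  calc β⁻¹ ^ M.δ t v * g v = β * (β⁻¹ ^ (M.δ t v + 1) * g v) := by
        rw [pow_succ']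
        field_simp
    _ ≤ β * (β⁻¹ ^ M.δ s v * g v) := by gcongr
    _ ≤ β * M.gmax β g s := by
        gcongr
        exact M.le_gmax_of_mul β g s v

lemma Mesh.gmax_rpow_le (M : Mesh d) (β : ℝ≥0) (g : {s // s ∈ M.cells} → ℝ≥0)
    (r : ℝ) (s : {s // s ∈ M.cells}) :
    M.gmax β g s ^ r ≤ ∑ t, (β⁻¹ ^ r) ^ M.δ s t * g t ^ r := by
  obtain ⟨t, -, ht⟩ := Finset.exists_mem_eq_sup Finset.univ ⟨s, Finset.mem_univ s⟩
    (fun t => β⁻¹ ^ M.δ s t * g t)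
  rw [Mesh.gmax, ht, NNReal.mul_rpow]
  have h1 : (β⁻¹ ^ M.δ s t) ^ r = (β⁻¹ ^ r) ^ M.δ s t := by
    rw [← NNReal.rpow_natCast, ← NNReal.rpow_natCast, ← NNReal.rpow_mul, ← NNReal.rpow_mul,
      mul_comm]
  rw [h1]
  exact Finset.single_le_sum (f := fun t => (β⁻¹ ^ r) ^ M.δ s t * g t ^ r)
    (fun _ _ => zero_le) (Finset.mem_univ t)

/-- The maximum is bounded by the sum over all simplices. After exchanging the sums, each `g t ^ r`
is multiplied by the weighted volume around `t`, which `hS` controls. -/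
lemma Mesh.sum_gmax_rpow_le (M : Mesh d) {β S : ℝ≥0} {r : ℝ} (hr : 0 ≤ r)
    (hS : ∀ s, ∑ t, ((β⁻¹ ^ r : ℝ≥0) : ℝ≥0∞) ^ M.δ t s * volume (simplex t.1) ≤
      S * volume (simplex s.1)) (g : {s // s ∈ M.cells} → ℝ≥0) :
    ∑ s, (M.gmax β g s : ℝ≥0∞) ^ r * volume (simplex s.1) ≤
      S * ∑ s, (g s : ℝ≥0∞) ^ r * volume (simplex s.1) := by
  calc ∑ s, (M.gmax β g s : ℝ≥0∞) ^ r * volume (simplex s.1)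
      ≤ ∑ s, (∑ t, ((β⁻¹ ^ r : ℝ≥0) : ℝ≥0∞) ^ M.δ s t * (g t : ℝ≥0∞) ^ r) *
          volume (simplex s.1) := by
        gcongr with s
        have h := M.gmax_rpow_le β g r s
        rw [← ENNReal.coe_rpow_of_nonneg _ hr]
        simp_rw [← ENNReal.coe_rpow_of_nonneg _ hr]
        exact_mod_cast h
    _ = ∑ t, (g t : ℝ≥0∞) ^ r *
          ∑ s, ((β⁻¹ ^ r : ℝ≥0) : ℝ≥0∞) ^ M.δ s t * volume (simplex s.1) := by
        simp_rw [Finset.sum_mul, Finset.mul_sum]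
        rw [Finset.sum_comm]
        refine Finset.sum_congr rfl fun t _ => Finset.sum_congr rfl fun s _ => ?_
        ring
    _ ≤ ∑ t, (g t : ℝ≥0∞) ^ r * (S * volume (simplex t.1)) := by
        gcongr with t
        exact hS t
    _ = _ := by
        rw [Finset.mul_sum]
        refine Finset.sum_congr rfl fun t _ => ?_
        ring

end MaximalFunction

/-! ### Extrapolation from `L²` to exponents above `2` -/

section LargeExponents

variable {d : ℕ}

/-- Extrapolation of the weighted `L²`-estimate: testing with arbitrary piecewise constants. -/
lemma sum_sq_le_of_weightedStable_two {M : Mesh d} {K : ℕ} {w : {s // s ∈ M.cells} → ℝ≥0}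
    {γ β : ℝ≥0} (hγ : 1 ≤ γ) (hβ : 1 ≤ β) (hw : M.Graded w γ) (hpos : ∀ s, 0 < w s) {C₀ : ℝ≥0}
    (hC₀ : ∀ ρ, M.IsWeight ρ (γ * β : ℝ≥0) → M.WeightedStable K 2 ρ C₀) {p r : ℝ≥0∞}
    [ENNReal.HolderTriple p r 2] (hp : 2 ≤ p) (hr0 : r ≠ 0) (hr : r ≠ ⊤) {S : ℝ≥0}
    (hS : ∀ s, ∑ t, ((β⁻¹ ^ r.toReal : ℝ≥0) : ℝ≥0∞) ^ M.δ t s * volume (simplex t.1) ≤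
      S * volume (simplex s.1)) {u : Euc d → ℝ} (hu : MemLp u p (volume.restrict M.Ω))
    {A : {s // s ∈ M.cells} → ℝ≥0} {C₁ : ℝ≥0}
    (hA : ∀ s : {s // s ∈ M.cells}, (A s : ℝ≥0∞) ^ 2 * volume (simplex s.1) ≤
      C₁ * ∫⁻ x in simplex s.1, ‖M.l2Proj K u x‖ₑ ^ 2)
    {g : {s // s ∈ M.cells} → ℝ≥0} (hg : ∃ t, 0 < g t) :
    ∑ s, ((w s * A s * g s : ℝ≥0) : ℝ≥0∞) ^ 2 * volume (simplex s.1) ≤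
      C₁ * (C₀ * (eLpNorm (fun x => M.pw w x * u x) p (volume.restrict M.Ω) *
        (S * ∑ s, (g s : ℝ≥0∞) ^ r.toReal * volume (simplex s.1)) ^ (1 / r.toReal))) ^ 2 := by
  let H := M.gmax β g
  -- The function `g` is arbitrary, so only `w H`, not `w g`, is known to be an admissible weight.
  -- `g ≤ H` recovers `g` on the left at the end.
  let W : {s // s ∈ M.cells} → ℝ≥0 := fun s => w s * H s
  have hW : M.IsWeight (M.pw W) (γ * β : ℝ≥0) :=
    (hw.mul (M.graded_gmax hβ g)).isWeight_pw (one_le_mul hγ hβ)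
      fun s => mul_pos (hpos s) (M.gmax_pos hβ hg s)
  have hstab := hC₀ _ hW u (hu.mono_exponent hp)
  have hR : 0 < r.toReal := ENNReal.toReal_pos hr0 hr
  have h1 : eLpNorm (fun x => M.pw W x * u x) 2 (volume.restrict M.Ω) ≤
      eLpNorm (fun x => M.pw w x * u x) p (volume.restrict M.Ω) *
        eLpNorm (M.pw H) r (volume.restrict M.Ω) := by
    have h2 : (fun x => M.pw W x * u x) =ᵐ[volume.restrict M.Ω]
        (fun x => M.pw w x * u x) • (M.pw H) := by
      filter_upwards [M.pw_mul_ae_eq w H] with x hx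
      simp only [W, hx, Pi.smul_apply', smul_eq_mul]
      ring
    rw [eLpNorm_congr_ae h2]
    exact eLpNorm_smul_le_mul_eLpNorm (M.measurable_pw H).aestronglyMeasurable
      ((M.measurable_pw w).aestronglyMeasurable.mul hu.1)
  have h3 : eLpNorm (M.pw H) r (volume.restrict M.Ω) ≤
      (S * ∑ s, (g s : ℝ≥0∞) ^ r.toReal * volume (simplex s.1)) ^ (1 / r.toReal) := by
    rw [one_div, ENNReal.le_rpow_inv_iff hR, M.eLpNorm_pw_rpow H hr0 hr]
    exact M.sum_gmax_rpow_le hR.le hS g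
  have h4 : eLpNorm (fun x => M.pw W x * M.l2Proj K u x) 2 (volume.restrict M.Ω) ^ 2 =
      ∑ s : {s // s ∈ M.cells}, (W s : ℝ≥0∞) ^ 2 *
        ∫⁻ x in simplex s.1, ‖M.l2Proj K u x‖ₑ ^ 2 := by
    simpa using M.eLpNorm_pw_mul_rpow W two_ne_zero ENNReal.ofNat_ne_top (M.l2Proj K u)
  calc ∑ s, ((w s * A s * g s : ℝ≥0) : ℝ≥0∞) ^ 2 * volume (simplex s.1)
      ≤ ∑ s : {s // s ∈ M.cells}, (W s : ℝ≥0∞) ^ 2 *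
          (C₁ * ∫⁻ x in simplex s.1, ‖M.l2Proj K u x‖ₑ ^ 2) := by
        refine Finset.sum_le_sum fun s _ => ?_
        have e : ((w s * A s * g s : ℝ≥0) : ℝ≥0∞) ^ 2 * volume (simplex s.1) =
            ((w s * g s : ℝ≥0) : ℝ≥0∞) ^ 2 * ((A s : ℝ≥0∞) ^ 2 * volume (simplex s.1)) := by
          push_cast
          ring
        rw [e]
        refine mul_le_mul' ?_ (hA s)
        gcongr
        exact mul_le_mul_right (M.le_gmax β g s) _
    _ = C₁ * eLpNorm (fun x => M.pw W x * M.l2Proj K u x) 2 (volume.restrict M.Ω) ^ 2 := by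
        rw [h4, Finset.mul_sum]
        exact Finset.sum_congr rfl fun s _ => mul_left_comm _ _ _
    _ ≤ _ := by
        gcongr
        exact hstab.trans (mul_le_mul_right (h1.trans (mul_le_mul_right h3 _)) _)

lemma ENNReal.le_of_sq_mul_le {a b N : ℝ≥0∞} (h0 : N ≠ 0) (ht : N ≠ ⊤)
    (h : a ^ 2 * N ≤ b ^ 2 * N) : a ≤ b := by
  rw [ENNReal.mul_le_mul_iff_left h0 ht] at h
  exact (ENNReal.pow_le_pow_left_iff two_ne_zero).1 h

/-- The weighted estimate for exponents above `2`. -/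
lemma weightedStable_of_two_lt {M : Mesh d} {K : ℕ} {w : {s // s ∈ M.cells} → ℝ≥0}
    {γ β : ℝ≥0} (hγ : 1 ≤ γ) (hβ : 1 ≤ β) (hw : M.Graded w γ) (hpos : ∀ s, 0 < w s) {C₀ : ℝ≥0}
    (hC₀ : ∀ ρ, M.IsWeight ρ (γ * β : ℝ≥0) → M.WeightedStable K 2 ρ C₀) {p r : ℝ≥0∞}
    [hpr : ENNReal.HolderTriple p r 2] (hp : 2 ≤ p) (hr0 : r ≠ 0) (hr : r ≠ ⊤) {S : ℝ≥0}
    (hS : ∀ s, ∑ t, ((β⁻¹ ^ r.toReal : ℝ≥0) : ℝ≥0∞) ^ M.δ t s * volume (simplex t.1) ≤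
      S * volume (simplex s.1)) {C₁ : ℝ≥0}
    (hC₁ : ∀ v, M.PiecewisePoly K v → ∃ A : {s // s ∈ M.cells} → ℝ≥0, ∀ s,
        (∀ᵐ x ∂volume.restrict (simplex s.1), ‖v x‖ₑ ≤ A s) ∧
        (A s : ℝ≥0∞) ^ 2 * volume (simplex s.1) ≤ C₁ * ∫⁻ x in simplex s.1, ‖v x‖ₑ ^ 2) :
    M.WeightedStable K p (M.pw w) (NNReal.sqrt C₁ * C₀ * S ^ (1 / r.toReal)) := by
  intro u hu
  have hR : 0 < r.toReal := ENNReal.toReal_pos hr0 hr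
  have hQ := M.l2Proj_spec K (hu.integrable (one_le_two.trans hp))
  obtain ⟨A, hA⟩ := hC₁ _ hQ.1.2
  -- Collects the constants into one square, so that square roots can be taken after cancelling the
  -- power of `N`.
  have hc : ∀ X N : ℝ≥0∞, C₁ * (C₀ * (X * (S * N) ^ (1 / r.toReal))) ^ 2 =
      ((NNReal.sqrt C₁ * C₀ * S ^ (1 / r.toReal) : ℝ≥0) * X) ^ 2 * (N ^ (1 / r.toReal)) ^ 2 := by
    intro X N
    rw [ENNReal.mul_rpow_of_nonneg _ _ (by positivity)]
    push_cast
    rw [ENNReal.coe_rpow_of_nonneg _ (by positivity)]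
    have e : (C₁ : ℝ≥0∞) = (NNReal.sqrt C₁ : ℝ≥0∞) ^ 2 := by
      rw [← ENNReal.coe_pow, NNReal.sq_sqrt]
    nth_rewrite 1 [e]
    ring
  have key := fun g hg => sum_sq_le_of_weightedStable_two hγ hβ hw hpos hC₀ hp hr0 hr hS hu
    (fun s => (hA s).2) (g := g) hg
  simp_rw [hc] at key
  set c : ℝ≥0 := NNReal.sqrt C₁ * C₀ * S ^ (1 / r.toReal)
  set X := eLpNorm (fun x => M.pw w x * u x) p (volume.restrict M.Ω)
  rcases eq_or_ne p ⊤ with rfl | hpt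
  · have hr2 : r.toReal = 2 := by
      have h := hpr.inv_add_inv_eq_inv
      rw [ENNReal.inv_top, zero_add, inv_inj] at h
      simp [h]
    have h1 : ∀ s, ((w s * A s : ℝ≥0) : ℝ≥0∞) ≤ c * X := by
      intro s
      refine ENNReal.le_of_sq_mul_le (M.volume_simplex_ne_zero s.2) (volume_simplex_ne_top s.1) ?_
      -- With `g` the indicator of `s` and `r = 2`, both sides carry the factor `|s|`, which
      -- cancels.
      have h2 := key (Pi.single s 1) ⟨s, by simp⟩
      rw [Finset.sum_eq_single s (fun t _ ht => by simp [ht]) (by simp),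
        Finset.sum_eq_single s (fun t _ ht => by simp [ht, hr2]) (by simp)] at h2
      rw [Pi.single_eq_same, mul_one, ENNReal.coe_one, ENNReal.one_rpow, one_mul, hr2] at h2
      refine h2.trans_eq ?_
      rw [← ENNReal.rpow_natCast (volume (simplex s.1) ^ ((1 : ℝ) / 2)), ← ENNReal.rpow_mul]
      norm_num
    rw [eLpNorm_exponent_top]
    refine eLpNormEssSup_le_of_ae_enorm_bound ?_
    rw [M.ae_domain_iff]
    intro s
    filter_upwards [(hA s).1, M.pw_ae_eq w s] with x h2 h3
    refine le_trans ?_ (h1 s)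
    rw [enorm_mul, h3]
    push_cast
    refine mul_le_mul' ?_ h2
    simp
  · have hp0 : p ≠ 0 := (two_pos.trans_le hp).ne'
    have hP : 0 < p.toReal := ENNReal.toReal_pos hp0 hpt
    have hPR : p.toReal⁻¹ + r.toReal⁻¹ = 2⁻¹ := by
      have h := congrArg ENNReal.toReal hpr.inv_add_inv_eq_inv
      rwa [ENNReal.toReal_add (ENNReal.inv_ne_top.2 hp0) (ENNReal.inv_ne_top.2 hr0),
        ENNReal.toReal_inv, ENNReal.toReal_inv, ENNReal.toReal_inv, ENNReal.toReal_ofNat] at h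
    let N : ℝ≥0∞ := ∑ s, ((w s * A s : ℝ≥0) : ℝ≥0∞) ^ p.toReal * volume (simplex s.1)
    have h1 : eLpNorm (fun x => M.pw w x * M.l2Proj K u x) p (volume.restrict M.Ω) ^ p.toReal
        ≤ N := by
      rw [M.eLpNorm_pw_mul_rpow w hp0 hpt]
      refine Finset.sum_le_sum fun s _ => ?_
      rw [ENNReal.coe_mul, ENNReal.mul_rpow_of_nonneg _ _ hP.le, mul_assoc]
      refine mul_le_mul_right ?_ _
      rw [← setLIntegral_const]
      refine lintegral_mono_ae ?_
      filter_upwards [(hA s).1] with x hx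
      exact ENNReal.rpow_le_rpow hx hP.le
    rw [← ENNReal.rpow_le_rpow_iff hP]
    refine h1.trans ?_
    rcases eq_or_ne N 0 with hN0 | hN0
    · rw [hN0]
      exact zero_le
    have hNt : N ≠ ⊤ := ENNReal.sum_ne_top.2 fun s _ => ENNReal.mul_ne_top
      (ENNReal.rpow_ne_top_of_nonneg hP.le ENNReal.coe_ne_top) (volume_simplex_ne_top s.1)
    -- The extremal choice in Hölder's inequality: since `1/p + 1/r = 1/2`, both `(w A g)²` and
    -- `g^r` equal `(w A)^p`. It is nonzero because `N ≠ 0`.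
    let g : {s // s ∈ M.cells} → ℝ≥0 := fun s => (w s * A s) ^ (p.toReal / r.toReal)
    have hg : ∃ t, 0 < g t := by
      by_contra! hcon
      refine hN0 (Finset.sum_eq_zero fun s _ => ?_)
      have h2 : w s * A s = 0 := by
        by_contra h3
        exact (NNReal.rpow_pos (pos_iff_ne_zero.2 h3)).not_ge (hcon s)
      rw [h2, ENNReal.coe_zero, ENNReal.zero_rpow_of_pos hP, zero_mul]
    have h2 := key g hg
    have e1 : ∀ s, ((w s * A s * g s : ℝ≥0) : ℝ≥0∞) ^ 2 =
        ((w s * A s : ℝ≥0) : ℝ≥0∞) ^ p.toReal := by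
      intro s
      rw [← ENNReal.coe_pow, ← ENNReal.coe_rpow_of_nonneg _ hP.le, ENNReal.coe_inj]
      simp only [g]
      rcases eq_or_ne (w s * A s) 0 with h0 | h0
      · rw [h0, NNReal.zero_rpow hP.ne', zero_mul, zero_pow two_ne_zero]
      · have e : w s * A s * (w s * A s) ^ (p.toReal / r.toReal) =
            (w s * A s) ^ (1 + p.toReal / r.toReal) := by
          rw [NNReal.rpow_add h0, NNReal.rpow_one]
        rw [e, ← NNReal.rpow_natCast, ← NNReal.rpow_mul]
        congr 1
        have : r.toReal⁻¹ = 2⁻¹ - p.toReal⁻¹ := by linarith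
        rw [div_eq_mul_inv, this]
        field_simp
        push_cast
        ring
    have e2 : ∀ s, (g s : ℝ≥0∞) ^ r.toReal = ((w s * A s : ℝ≥0) : ℝ≥0∞) ^ p.toReal := by
      intro s
      rw [← ENNReal.coe_rpow_of_nonneg _ hP.le, ← ENNReal.coe_rpow_of_nonneg _ hR.le,
        ENNReal.coe_inj, ← NNReal.rpow_mul, div_mul_cancel₀ _ hR.ne']
    simp_rw [e1, e2] at h2
    change N ≤ (c * X) ^ 2 * (N ^ (1 / r.toReal)) ^ 2 at h2
    have h3 : N ^ (1 / p.toReal) ≤ c * X := by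
      have hM0 : (N ^ (1 / r.toReal)) ^ 2 ≠ 0 := by
        simp [hN0, hNt]
      have hMt : (N ^ (1 / r.toReal)) ^ 2 ≠ ⊤ :=
        ENNReal.pow_ne_top (ENNReal.rpow_ne_top_of_nonneg (by positivity) hNt)
      -- `N = (N^(1/p))² (N^(1/r))²`, and the second factor is cancelled; this needs `0 < N < ∞`.
      refine ENNReal.le_of_sq_mul_le hM0 hMt (le_trans (le_of_eq ?_) h2)
      rw [← mul_pow, ← ENNReal.rpow_add _ _ hN0 hNt, one_div, one_div, hPR,
        ← ENNReal.rpow_natCast, ← ENNReal.rpow_mul]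
      norm_num
    calc N = (N ^ (1 / p.toReal)) ^ p.toReal := by
          rw [← ENNReal.rpow_mul, one_div_mul_cancel hP.ne', ENNReal.rpow_one]
      _ ≤ _ := ENNReal.rpow_le_rpow h3 hP.le

end LargeExponents

/-! ### Exponents below `2` by duality -/

section Duality

variable {d : ℕ}

/-- Equality holds for `t ≠ 0`; at `t = 0` with `P = 1` the right side is `0 ^ 0 = 1`. -/
lemma abs_dual_le (P t : ℝ) : |t * |t| ^ (P - 2)| ≤ |t| ^ (P - 1) := by
  rcases eq_or_ne t 0 with rfl | ht
  · simp only [zero_mul, abs_zero]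
    exact Real.rpow_nonneg le_rfl _
  · have ht' : 0 < |t| := abs_pos.2 ht
    rw [abs_mul, abs_of_nonneg (Real.rpow_nonneg ht'.le _)]
    nth_rewrite 1 [← Real.rpow_one |t|]
    rw [← Real.rpow_add ht']
    apply le_of_eq
    congr 1
    ring

lemma mul_dual_eq {P : ℝ} (hP : 1 ≤ P) (t : ℝ) : t * (t * |t| ^ (P - 2)) = |t| ^ P := by
  rcases eq_or_ne t 0 with rfl | ht
  · rw [zero_mul, abs_zero, Real.zero_rpow (by linarith)]
  · have ht' : 0 < |t| := abs_pos.2 ht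
    rw [← mul_assoc, ← abs_mul_abs_self t, ← sq, ← Real.rpow_natCast, ← Real.rpow_add ht']
    congr 1
    push_cast
    ring

lemma Triangulation.pw_inv_mul_ae_eq (M : Triangulation d) {w : {s // s ∈ M.cells} → ℝ≥0}
    (hpos : ∀ s, 0 < w s) :
    ∀ᵐ x ∂volume.restrict M.Ω, M.pw (fun s => (w s)⁻¹) x * M.pw w x = 1 := by
  rw [M.ae_domain_iff]
  intro s
  filter_upwards [M.pw_ae_eq w s, M.pw_ae_eq (fun s => (w s)⁻¹) s] with x h1 h2
  rw [h1, h2]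
  exact_mod_cast inv_mul_cancel₀ (hpos s).ne'

/-- The function dual to `f` is bounded by `|f|^(p-1)`, and `(p - 1) q = p`. For `p = 1`, `q = ∞` it
is bounded by `1`, which matches the exponent `0` on the right. -/
lemma eLpNorm_dual_le {μ : Measure (Euc d)} {f : Euc d → ℝ} {p q : ℝ≥0∞}
    [hpq : p.HolderConjugate q] (hp : p ≠ ⊤) :
    eLpNorm (fun x => f x * |f x| ^ (p.toReal - 2)) q μ ≤
      (∫⁻ x, ‖f x‖ₑ ^ p.toReal ∂μ) ^ (q⁻¹).toReal := by
  have hp1 : 1 ≤ p := hpq.one_le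
  have hP : 1 ≤ p.toReal := by
    rw [← ENNReal.toReal_one]
    exact ENNReal.toReal_mono hp hp1
  have hb : ∀ x, ‖f x * |f x| ^ (p.toReal - 2)‖ₑ ≤ ‖f x‖ₑ ^ (p.toReal - 1) := fun x => by
    rw [← ofReal_norm, ← ofReal_norm, ENNReal.ofReal_rpow_of_nonneg (norm_nonneg _) (by linarith)]
    exact ENNReal.ofReal_le_ofReal (abs_dual_le p.toReal (f x))
  rcases eq_or_ne q ⊤ with rfl | hq
  · have h1 : p = 1 := by
      have h := hpq.inv_add_inv_eq_inv
      rwa [ENNReal.inv_top, add_zero, inv_inj] at h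
    rw [ENNReal.inv_top, ENNReal.toReal_zero, ENNReal.rpow_zero, eLpNorm_exponent_top]
    refine eLpNormEssSup_le_of_ae_enorm_bound (.of_forall fun x => (hb x).trans_eq ?_)
    simp [h1]
  · have hq1 : 1 ≤ q := hpq.symm.one_le
    have hq0 : q ≠ 0 := (zero_lt_one.trans_le hq1).ne'
    have hQ : 0 < q.toReal := ENNReal.toReal_pos hq0 hq
    have hPQ : p.toReal⁻¹ + q.toReal⁻¹ = 1 := by
      have h := congrArg ENNReal.toReal hpq.inv_add_inv_eq_inv
      rwa [ENNReal.toReal_add (ENNReal.inv_ne_top.2 (zero_lt_one.trans_le hp1).ne')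
        (ENNReal.inv_ne_top.2 hq0), ENNReal.toReal_inv, ENNReal.toReal_inv, inv_one,
        ENNReal.toReal_one] at h
    rw [eLpNorm_eq_lintegral_rpow_enorm_toReal hq0 hq, ENNReal.toReal_inv, one_div]
    refine ENNReal.rpow_le_rpow (lintegral_mono fun x => ?_) (by positivity)
    refine (ENNReal.rpow_le_rpow (hb x) hQ.le).trans_eq ?_
    rw [← ENNReal.rpow_mul]
    congr 1
    field_simp at hPQ
    linarith

/-- The weighted estimate for `p` follows from the one for the dual exponent and weight, because
the `L²`-projection is self-adjoint. -/
lemma weightedStable_of_conjugate (M : Triangulation d) {K : ℕ} {w : {s // s ∈ M.cells} → ℝ≥0}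
    (hpos : ∀ s, 0 < w s) {p q : ℝ≥0∞} [hpq : p.HolderConjugate q] (hp : p ≠ ⊤) {C : ℝ≥0}
    (hC : M.WeightedStable K q (M.pw fun s => (w s)⁻¹) C) :
    M.WeightedStable K p (M.pw w) C := by
  intro u hu
  let μ := volume.restrict M.Ω
  have hp1 : 1 ≤ p := hpq.one_le
  have hp0 : p ≠ 0 := (zero_lt_one.trans_le hp1).ne'
  have hP : 1 ≤ p.toReal := by
    rw [← ENNReal.toReal_one]
    exact ENNReal.toReal_mono hp hp1
  have hP0 : 0 < p.toReal := zero_lt_one.trans_le hP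
  have hui : Integrable u μ := hu.integrable hp1
  have hQu := M.l2Proj_spec K hui
  set v := M.l2Proj K u
  have hv : MemLp v ⊤ μ := hQu.1.1.1
  have hwt : MemLp (M.pw w) ⊤ μ := M.memLp_pw w ⊤
  let f : Euc d → ℝ := fun x => M.pw w x * v x
  have hf : MemLp f ⊤ μ := hv.mul hwt
  -- `φ` is the dual function of `f = w Qu`, so `∫ f φ = ∫ |f|^p`. It is bounded because `Qu` is,
  -- hence `w φ` is integrable and can be projected.
  let φ : Euc d → ℝ := fun x => f x * |f x| ^ (p.toReal - 2)
  have hφm : AEStronglyMeasurable φ μ := by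
    have hψ : Measurable fun t : ℝ => t * |t| ^ (p.toReal - 2) := by fun_prop
    exact (hψ.comp_aemeasurable hf.1.aemeasurable).aestronglyMeasurable
  have hφ : MemLp φ ⊤ μ := by
    refine MemLp.of_bound hφm ((eLpNorm f ⊤ μ).toReal ^ (p.toReal - 1)) ?_
    filter_upwards [ae_le_eLpNormEssSup (f := f) (μ := μ)] with x hx
    refine (abs_dual_le p.toReal (f x)).trans (Real.rpow_le_rpow (abs_nonneg _) ?_ (by linarith))
    rw [← eLpNorm_exponent_top] at hx
    have h := ENNReal.toReal_mono hf.2.ne hx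
    rwa [toReal_enorm] at h
  let y : Euc d → ℝ := fun x => M.pw w x * φ x
  have hy : MemLp y ⊤ μ := hφ.mul hwt
  have hQy := M.l2Proj_spec K (hy.integrable le_top)
  set z := M.l2Proj K y
  have hz : MemLp z ⊤ μ := hQy.1.1.1
  let N := ∫⁻ x, ‖f x‖ₑ ^ p.toReal ∂μ
  -- Self-adjointness of `Q`, from testing each projection with the other: `∫ y Qu = ∫ Qy Qu = ∫ u
  -- Qy`.
  have e1 : ∫ x, f x * φ x ∂μ = ∫ x, u x * z x ∂μ := by
    calc ∫ x, f x * φ x ∂μ = ∫ x, y x * v x ∂μ := by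
          refine integral_congr_ae (.of_forall fun x => ?_)
          simp only [f, y]
          ring
      _ = ∫ x, z x * v x ∂μ := (hQy.2 v hQu.1).symm
      _ = ∫ x, v x * z x ∂μ := by simp_rw [mul_comm]
      _ = ∫ x, u x * z x ∂μ := hQu.2 z hQy.1
  have e2 : N = ENNReal.ofReal (∫ x, f x * φ x ∂μ) := by
    have hi : Integrable (fun x => f x * φ x) μ := (hf.integrable le_top).mul_of_top_left hφ
    have hpw : ∀ x, f x * φ x = |f x| ^ p.toReal := fun x => mul_dual_eq hP (f x)
    rw [ofReal_integral_eq_lintegral_ofReal hi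
      (.of_forall fun x => by simp only [hpw]; positivity)]
    refine lintegral_congr fun x => ?_
    rw [hpw, ← ofReal_norm, ENNReal.ofReal_rpow_of_nonneg (norm_nonneg _) hP0.le, Real.norm_eq_abs]
  set X := eLpNorm (fun x => M.pw w x * u x) p μ
  have e3 : eLpNorm (fun x => u x * z x) 1 μ ≤
      X * eLpNorm (fun x => M.pw (fun s => (w s)⁻¹) x * z x) q μ := by
    have h : (fun x => u x * z x) =ᵐ[μ]
        (fun x => M.pw w x * u x) • (fun x => M.pw (fun s => (w s)⁻¹) x * z x) := by
      filter_upwards [M.pw_inv_mul_ae_eq hpos] with x hx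
      simp only [Pi.smul_apply', smul_eq_mul]
      linear_combination (-(u x * z x)) * hx
    rw [eLpNorm_congr_ae h]
    exact eLpNorm_smul_le_mul_eLpNorm ((M.measurable_pw _).aestronglyMeasurable.mul hz.1)
      ((M.measurable_pw w).aestronglyMeasurable.mul hu.1)
  have e4 : eLpNorm (fun x => M.pw (fun s => (w s)⁻¹) x * y x) q μ = eLpNorm φ q μ := by
    refine eLpNorm_congr_ae ?_
    filter_upwards [M.pw_inv_mul_ae_eq hpos] with x hx
    simp only [y]
    rw [← mul_assoc, hx, one_mul]
  have e5 : N ≤ X * (C * N ^ (q⁻¹).toReal) := by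
    calc N = ENNReal.ofReal (∫ x, u x * z x ∂μ) := by rw [e2, e1]
      _ ≤ ‖∫ x, u x * z x ∂μ‖ₑ := by
        rw [← ofReal_norm]
        exact ENNReal.ofReal_le_ofReal (Real.le_norm_self _)
      _ ≤ ∫⁻ x, ‖u x * z x‖ₑ ∂μ := enorm_integral_le_lintegral_enorm _
      _ = eLpNorm (fun x => u x * z x) 1 μ := eLpNorm_one_eq_lintegral_enorm.symm
      _ ≤ X * eLpNorm (fun x => M.pw (fun s => (w s)⁻¹) x * z x) q μ := e3
      _ ≤ X * (C * eLpNorm φ q μ) := by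
        rw [← e4]
        exact mul_le_mul_right (hC y (hy.mono_exponent le_top)) _
      _ ≤ X * (C * N ^ (q⁻¹).toReal) := by
        gcongr
        exact eLpNorm_dual_le hp
  have e6 : eLpNorm f p μ = N ^ (p⁻¹).toReal := by
    rw [eLpNorm_eq_lintegral_rpow_enorm_toReal hp0 hp, ENNReal.toReal_inv, one_div]
  have hNt : N ≠ ⊤ := by
    have h : eLpNorm f p μ ≠ ⊤ := (hf.mono_exponent le_top).2.ne
    rw [e6] at h
    intro hN
    rw [hN, ENNReal.toReal_inv, ENNReal.top_rpow_of_pos (inv_pos.2 hP0)] at h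
    exact h rfl
  change eLpNorm f p μ ≤ _
  rw [e6]
  rcases eq_or_ne N 0 with hN0 | hN0
  · rw [hN0, ENNReal.toReal_inv, ENNReal.zero_rpow_of_pos (inv_pos.2 hP0)]
    exact zero_le
  have hq0 : q ≠ 0 := (zero_lt_one.trans_le hpq.symm.one_le).ne'
  have hsum : (p⁻¹).toReal + (q⁻¹).toReal = 1 := by
    rw [← ENNReal.toReal_add (ENNReal.inv_ne_top.2 hp0) (ENNReal.inv_ne_top.2 hq0),
      hpq.inv_add_inv_eq_inv, inv_one, ENNReal.toReal_one]
  have hq0' : N ^ (q⁻¹).toReal ≠ 0 := by simp [hN0, hNt]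
  have hqt : N ^ (q⁻¹).toReal ≠ ⊤ := ENNReal.rpow_ne_top_of_nonneg ENNReal.toReal_nonneg hNt
  -- Multiplying the goal by `N^(1/q)` turns its left side into `N`, so that `e5` applies.
  rw [← ENNReal.mul_le_mul_iff_left hq0' hqt, ← ENNReal.rpow_add _ _ hN0 hNt, hsum,
    ENNReal.rpow_one]
  refine e5.trans_eq ?_
  ring

end Duality

/-! ### Choice of the parameters and the theorem -/

section Main

variable {d : ℕ}

/-- The weighted estimate for piecewise constant weights and exponents above `2`. -/
lemma exists_weightedStable_of_two_lt {K : ℕ} {χ κ γρ γh : ℝ} {p : ℝ≥0∞} (hp : 2 < p)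
    {𝔗 : Set (Mesh d)} (hreg : ∀ M ∈ 𝔗, M.ShapeRegular χ) (hρ : 1 ≤ γρ) (hh : 1 ≤ γh)
    (hγ : ENNReal.ofReal (γρ * γh ^ ((d : ℝ) * |1 / 2 - (p⁻¹).toReal|)) < worstGrading 𝔗 K) :
    ∃ c : ℝ≥0, ∀ M ∈ 𝔗, ∀ w : {s // s ∈ M.cells} → ℝ≥0, (∀ s, 0 < w s) →
      M.Graded w γρ.toNNReal → ∀ h, M.IsMeshSize h γh κ → M.WeightedStable K p (M.pw w) c := by
  have hp0 : p ≠ 0 := (two_pos.trans hp).ne'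
  have hinv : p⁻¹ < 2⁻¹ := ENNReal.inv_lt_inv.2 hp
  let r : ℝ≥0∞ := (2⁻¹ - p⁻¹)⁻¹
  have hpr : ENNReal.HolderTriple p r 2 := ⟨by
    rw [inv_inv, add_tsub_cancel_of_le hinv.le]⟩
  have hr : r ≠ ⊤ := ENNReal.inv_ne_top.2 (tsub_pos_of_lt hinv).ne'
  have hr0 : r ≠ 0 := ENNReal.inv_ne_zero.2 (ENNReal.sub_ne_top (by simp))
  have hR : 0 < r.toReal := ENNReal.toReal_pos hr0 hr
  have hα : |1 / 2 - (p⁻¹).toReal| = r.toReal⁻¹ := by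
    have h1 : r.toReal⁻¹ = 2⁻¹ - (p⁻¹).toReal := by
      rw [← ENNReal.toReal_inv, inv_inv, ENNReal.toReal_sub_of_le hinv.le (by simp)]
      simp
    rw [one_div, ← h1, abs_of_pos (inv_pos.2 hR)]
  rw [hα] at hγ
  obtain ⟨Γ, hΓ, hlt⟩ := lt_sSup_iff.1 hγ
  -- The total grading `x = γρ β` is placed strictly between `γρ γh^(d/r)` and the admissible bound
  -- `Γ`: the lower gap gives `γh^d β^(-r) < 1`, the upper one the weighted `L²`-estimate for
  -- grading `x`.
  obtain ⟨x, hx1, hx2⟩ := ENNReal.lt_iff_exists_nnreal_btwn.1 hlt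
  lift γρ to ℝ≥0 using zero_le_one.trans hρ
  lift γh to ℝ≥0 using zero_le_one.trans hh
  rw [Real.toNNReal_coe]
  have hρ' : 1 ≤ γρ := by exact_mod_cast hρ
  have hh' : 1 ≤ γh := by exact_mod_cast hh
  have hρ0 : 0 < γρ := zero_lt_one.trans_le hρ'
  have hx1' : γρ * γh ^ ((d : ℝ) * r.toReal⁻¹) < x := by
    rw [← NNReal.coe_rpow, ← NNReal.coe_mul, ENNReal.ofReal_coe_nnreal] at hx1
    exact_mod_cast hx1
  let β : ℝ≥0 := x / γρ
  have hβx : γρ * β = x := mul_div_cancel₀ _ hρ0.ne'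
  have hβ1 : γh ^ ((d : ℝ) * r.toReal⁻¹) < β := by
    rw [← hβx] at hx1'
    exact lt_of_mul_lt_mul_left hx1' zero_le
  have hβ : 1 ≤ β := (NNReal.one_le_rpow hh' (by positivity)).trans hβ1.le
  have hq : γh ^ d * β⁻¹ ^ r.toReal < 1 := by
    have h1 : γh ^ d < β ^ r.toReal := by
      have h2 := NNReal.rpow_lt_rpow hβ1 hR
      rwa [← NNReal.rpow_mul, mul_assoc, inv_mul_cancel₀ hR.ne', mul_one, NNReal.rpow_natCast] at h2
    rw [NNReal.inv_rpow, ← div_eq_mul_inv, div_lt_one (zero_le.trans_lt h1)]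
    exact h1
  obtain ⟨C₀, hC₀⟩ := hΓ x (by
    rw [← hβx]
    exact_mod_cast one_le_mul hρ' hβ) (by rwa [ENNReal.ofReal_coe_nnreal])
  obtain ⟨C₁, hC₁⟩ := exists_inverse_estimate d K χ
  obtain ⟨S, hS⟩ := exists_sum_volume_le d χ (κ := κ.toNNReal) hh' hq
  refine ⟨NNReal.sqrt C₁ * C₀ * S ^ (1 / r.toReal), fun M hM w hpos hw h hhm => ?_⟩
  have hm : M.Graded (M.cellInf h) γh := by
    have := hhm.isWeight.graded_cellInf
    rwa [Real.toNNReal_coe] at this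
  have hκ : ∀ s, Metric.diam (simplex s.1) ≤ κ.toNNReal * M.cellInf h s := by
    intro s
    have h1 := hhm.diam_le s.1 s.2
    rw [← M.coe_cellInf] at h1
    have h2 : ENNReal.ofReal (Metric.diam (simplex s.1)) ≤
        ((κ.toNNReal * M.cellInf h s : ℝ≥0) : ℝ≥0∞) := by
      rw [ENNReal.coe_mul]
      exact h1
    rw [ENNReal.ofReal_le_coe] at h2
    exact_mod_cast h2
  have hκ' : ∀ s, M.cellInf h s ≤ κ.toNNReal * Metric.diam (simplex s.1) := by
    intro s
    have h1 := (infOn_le_supOn M.toTriangulation s h).trans (hhm.le_diam s.1 s.2)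
    rw [← M.coe_cellInf] at h1
    have h2 : (M.cellInf h s : ℝ≥0∞) ≤
        ((κ.toNNReal * (Metric.diam (simplex s.1)).toNNReal : ℝ≥0) : ℝ≥0∞) := by
      rw [ENNReal.coe_mul]
      exact h1
    have h3 := NNReal.coe_le_coe.2 (ENNReal.coe_le_coe.1 h2)
    rwa [NNReal.coe_mul, Real.coe_toNNReal _ Metric.diam_nonneg] at h3
  refine weightedStable_of_two_lt hρ' hβ hw hpos (fun ρ hρw => hC₀ M hM ρ ?_) hp.le hr0 hr
    (hS M (hreg M hM) _ hm hκ hκ') (hC₁ M.toTriangulation (hreg M hM))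
  rwa [hβx] at hρw

end Main

end WeightedLp

/-- The constant `c` is uniform over all meshes of the family, all weights, all mesh size functions
and all `u`. -/
theorem theorem4p10 (d : ℕ) (hd : 1 ≤ d) (K : ℕ) (χ₀ κ γρ γh : ℝ) (p : ℝ≥0∞) (hp : 1 ≤ p)
    (𝔗 : Set (WeightedLp.Mesh d)) (hreg : ∀ M ∈ 𝔗, M.ShapeRegular χ₀)
    (hγ : ENNReal.ofReal (γρ * γh ^ ((d : ℝ) * |1 / 2 - (p⁻¹).toReal|)) <
      WeightedLp.worstGrading 𝔗 K) :
    ∃ c : ℝ≥0, ∀ M ∈ 𝔗, ∀ ρ h : WeightedLp.Euc d → ℝ,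
      M.IsWeight ρ γρ → M.IsMeshSize h γh κ → M.WeightedStable K p ρ c := by
  -- Weights and mesh size functions have grading at least `1`, so otherwise the claim is vacuous.
  by_cases hρ : 1 ≤ γρ
  swap
  · exact ⟨0, fun M _ ρ h hw _ => absurd hw.one_le hρ⟩
  by_cases hh : 1 ≤ γh
  swap
  · exact ⟨0, fun M _ ρ h _ hm => absurd hm.isWeight.one_le hh⟩
  rcases lt_trichotomy p 2 with hp2 | rfl | hp2
  · let q : ℝ≥0∞ := (1 - p⁻¹)⁻¹
    have hp1 : p⁻¹ ≤ 1 := ENNReal.inv_le_one.2 hp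
    have hpq : p.HolderConjugate q := ⟨by rw [inv_inv, add_tsub_cancel_of_le hp1, inv_one]⟩
    have hpinv : (2 : ℝ≥0∞)⁻¹ < p⁻¹ := ENNReal.inv_lt_inv.2 hp2
    have hq2 : 2 < q := by
      rw [← ENNReal.inv_lt_inv, inv_inv]
      refine ENNReal.sub_lt_of_lt_add hp1 ?_
      calc (1 : ℝ≥0∞) = 2⁻¹ + 2⁻¹ := (ENNReal.inv_two_add_inv_two).symm
        _ < 2⁻¹ + p⁻¹ := ENNReal.add_lt_add_left (by simp) hpinv
    -- Conjugate exponents have reciprocals symmetric about `1/2`, so the grading condition for `p`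
    -- is also the one for `q > 2`.
    have hα : |1 / 2 - (q⁻¹).toReal| = |1 / 2 - (p⁻¹).toReal| := by
      rw [inv_inv, ENNReal.toReal_sub_of_le hp1 ENNReal.one_ne_top, ENNReal.toReal_one, ← abs_neg]
      congr 1
      ring
    rw [← hα] at hγ
    obtain ⟨c, hc⟩ := WeightedLp.exists_weightedStable_of_two_lt (κ := κ) hq2 hreg hρ hh hγ
    refine ⟨γρ.toNNReal * c, fun M hM ρ h hw hm => hw.weightedStable_of_cellInf ?_⟩
    exact WeightedLp.weightedStable_of_conjugate M.toTriangulation hw.cellInf_pos (hp2.trans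
      ENNReal.ofNat_lt_top).ne (hc M hM _ (fun s => inv_pos.2 (hw.cellInf_pos s))
        (hw.graded_cellInf.inv hw.cellInf_pos) h hm)
  · have h0 : (1 / 2 : ℝ) - ((2 : ℝ≥0∞)⁻¹).toReal = 0 := by simp
    rw [h0, abs_zero, mul_zero, Real.rpow_zero, mul_one] at hγ
    obtain ⟨Γ, hΓ, hlt⟩ := lt_sSup_iff.1 hγ
    obtain ⟨C, hC⟩ := hΓ γρ hρ hlt
    exact ⟨C, fun M hM ρ _ hw _ => hC M hM ρ hw⟩
  · obtain ⟨c, hc⟩ := WeightedLp.exists_weightedStable_of_two_lt (κ := κ) hp2 hreg hρ hh hγ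
    exact ⟨γρ.toNNReal * c, fun M hM ρ h hw hm => hw.weightedStable_of_cellInf
      (hc M hM _ hw.cellInf_pos hw.graded_cellInf h hm)⟩
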